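/- Let $E$ be a complex Banach lattice: the complexification $E=X+iX$ of a real Banach lattice $X=E_{\mathbb R}$, with modulus $|x+iy|=\sup_{\theta}(x\cos\theta+y\sin\theta)\in X$ and norm $\|z\|=\|\,|z|\,\|$. An $m$-homogeneous polynomial $P(z)=A(z,\dots,z)$ on $E$ ($A$ a symmetric $m$-linear form) is written $P=P_0+iP_1$, where $P_0,P_1$ are the $m$-homogeneous polynomials on $X$ whose symmetric forms are $\operatorname{Re}A$ and $\operatorname{Im}A$ restricted to $X^m$. A real polynomial on $X$ is positive if its symmetric form is nonnegative on tuples of nonnegative vectors, and this defines an order on real $m$-homogeneous polynomials ($Q\le R$ if $R-Q$ is positive). $P$ is regular if each of $P_0,P_1$ is a difference of two positive polynomials; then $|P|=\sup_\theta(P_0\cos\theta+P_1\sin\theta)$ in this order, extended to $E$ by complexification. Put $\|P\|=\sup_{\|z\|\le 1}|P(z)|$ and $\|P\|_r=\|\,|P|\,\|$. For $m\ge 1$ let $$K_m(B_E)=\sup\{\rho\ge 0:\ \rho^m\|P\|_r\le\|P\|\text{ for all regular }m\text{-homogeneous polynomials }P\text{ on }E\}.$$ Let $U\subseteq E$ be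 open. A function $f\colon U\to\mathbb C$ is regularly holomorphic if it is holomorphic, all its Taylor polynomials $\hat d^m f(z)/m!$, $z\in U$, are regular, and for every $z\in U$, writing $P_m=\hat d^mf(z)/m!$, the series $\sum_m|P_m|(|w|)$ converges for all $w$ in some neighbourhood of $0$. For $a\in U$ and $P_m=\hat d^mf(a)/m!$ put $$r(f,a)=\Bigl(\limsup_m\|P_m\|^{1/m}\Bigr)^{-1},\qquad |r|(f,a)=\Bigl(\limsup_m\|P_m\|_r^{1/m}\Bigr)^{-1}$$ in $[0,\infty]$ (with $1/0=\infty$, $1/\infty=0$, $0\cdot\infty=0$), and let $\kappa=\liminf_{m\to\infty}K_m(B_E)$. **Theorem.** If $f\colon U\to\mathbb C$ is regularly holomorphic and $a\in U$, then $$\kappa\, r(f,a)\le |r|(f,a)\le r(f,a).$$ Moreover, if $E\ne\{0\}$, both bounds are sharp at every point: for every bounded open set $V\subseteq E$ and every $a\in V$, 1. there is a regularly holomorphic $f\colon V\to\mathbb C$ with $r(f,a)<\infty$ and $|r|(f,a)=r(f,a)$; 2. if $\kappa>0$, there is a regularly holomorphic $f\colon V\to\mathbb C$ with $r(f,a)<\infty$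 and $|r|(f,a)=\kappa\,r(f,a)$; 3. if $\kappa=0$, then for every $\varepsilon>0$ there is a regularly holomorphic $f\colon V\to\mathbb C$ with $r(f,a)<\infty$ and $|r|(f,a)\le\varepsilon\, r(f,a)$. -/

import Mathlib

open Filter
open scoped ENNReal NNReal Nat

/-- The real Banach lattice `X` together with the complex normed space `E` forms a complex Banach
lattice: `E` is the vector space complexification of `X` (every `z` is uniquely `x + i y` with
`x y : X`), the modulus is `|z| = sup_θ (x cos θ + y sin θ)`, computed in `X`, and
`‖z‖ = ‖ |z| ‖`. The modulus, the real part and the imaginary part are determined by `ofReal`. -/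
structure ComplexBanachLattice (X E : Type*)
    [NormedAddCommGroup X] [Lattice X] [IsOrderedAddMonoid X] [HasSolidNorm X]
    [NormedSpace ℝ X] [IsOrderedModule ℝ X] [CompleteSpace X]
    [NormedAddCommGroup E] [NormedSpace ℂ E] where
  /-- the inclusion of the real part -/
  ofReal : X →ₗ[ℝ] E
  /-- the real part of a vector -/
  re : E → X
  /-- the imaginary part of a vector -/
  im : E → X
  /-- the modulus of a vector -/
  abs : E → X
  re_add_im : ∀ z : E, z = ofReal (re z) + Complex.I • ofReal (im z)
  unique_re_im : ∀ x y x' y' : X,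
    ofReal x + Complex.I • ofReal y = ofReal x' + Complex.I • ofReal y' → x = x' ∧ y = y'
  isLUB_abs : ∀ z : E,
    IsLUB (Set.range fun θ : ℝ => Real.cos θ • re z + Real.sin θ • im z) (abs z)
  norm_eq : ∀ z : E, ‖z‖ = ‖abs z‖

/-- An `m`-homogeneous polynomial `P z = A (z, …, z)` is handled through its unique symmetric
`m`-linear form `A`. -/
def IsSymmForm {R M N : Type*} [CommRing R] [AddCommGroup M] [Module R M]
    [AddCommGroup N] [Module R N] {m : ℕ} (A : MultilinearMap R (fun _ : Fin m => M) N) : Prop :=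
  ∀ (σ : Equiv.Perm (Fin m)) (x : Fin m → M), A (fun i => x (σ i)) = A x

/-- The order on real polynomials: `A ≤ B` when `B - A` is positive, that is, nonnegative on all
tuples of nonnegative vectors. -/
def FormLE {X : Type*} [AddCommGroup X] [PartialOrder X] [Module ℝ X] {m : ℕ}
    (A B : MultilinearMap ℝ (fun _ : Fin m => X) ℝ) : Prop :=
  ∀ x : Fin m → X, (∀ i, 0 ≤ x i) → A x ≤ B x

/-- A real homogeneous polynomial is regular when it is the difference of two positive ones. -/
def IsRegularReal {X : Type*} [AddCommGroup X] [PartialOrder X] [Module ℝ X] {m : ℕ}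
    (A : MultilinearMap ℝ (fun _ : Fin m => X) ℝ) : Prop :=
  ∃ B C : MultilinearMap ℝ (fun _ : Fin m => X) ℝ,
    IsSymmForm B ∧ IsSymmForm C ∧ FormLE 0 B ∧ FormLE 0 C ∧ A = B - C

/-- The supremum norm `‖P‖ = sup {|P z| : ‖z‖ ≤ 1}` of `P z = A (z, …, z)`. -/
noncomputable def supNorm {E : Type*} [NormedAddCommGroup E] [NormedSpace ℂ E] {m : ℕ}
    (A : MultilinearMap ℂ (fun _ : Fin m => E) ℂ) : ℝ≥0∞ :=
  ⨆ z : E, ⨆ _ : ‖z‖ ≤ 1, ‖A (fun _ => z)‖ₑ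

/-- The symmetric form of the `m`-th Taylor polynomial of `f` at `a`. -/
noncomputable def taylorForm {E : Type*} [NormedAddCommGroup E] [NormedSpace ℂ E]
    (f : E → ℂ) (a : E) (m : ℕ) : MultilinearMap ℂ (fun _ : Fin m => E) ℂ :=
  ((m ! : ℂ)⁻¹ • iteratedFDeriv ℂ m f a).toMultilinearMap

/-- The radius of convergence `r(f, a) = (limsup ‖P_m‖^{1/m})⁻¹`, with values in `[0, ∞]`. -/
noncomputable def convRadius {E : Type*} [NormedAddCommGroup E] [NormedSpace ℂ E]
    (f : E → ℂ) (a : E) : ℝ≥0∞ :=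
  (limsup (fun m : ℕ => supNorm (taylorForm f a m) ^ (1 / (m : ℝ))) atTop)⁻¹

namespace ComplexBanachLattice

variable {X E : Type*}
  [NormedAddCommGroup X] [Lattice X] [IsOrderedAddMonoid X] [HasSolidNorm X]
  [NormedSpace ℝ X] [IsOrderedModule ℝ X] [CompleteSpace X]
  [NormedAddCommGroup E] [NormedSpace ℂ E]
  (L : ComplexBanachLattice X E) {m : ℕ}

/-- The restriction of a complex form to real vectors. -/
noncomputable def restrict (A : MultilinearMap ℂ (fun _ : Fin m => E) ℂ) :
    MultilinearMap ℝ (fun _ : Fin m => X) ℂ :=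
  (A.restrictScalars ℝ).compLinearMap (fun _ => L.ofReal)

/-- The real part of a complex form, as a real form on `X`. -/
noncomputable def reForm (A : MultilinearMap ℂ (fun _ : Fin m => E) ℂ) :
    MultilinearMap ℝ (fun _ : Fin m => X) ℝ :=
  Complex.reLm.compMultilinearMap (L.restrict A)

/-- The imaginary part of a complex form, as a real form on `X`. -/
noncomputable def imForm (A : MultilinearMap ℂ (fun _ : Fin m => E) ℂ) :
    MultilinearMap ℝ (fun _ : Fin m => X) ℝ :=
  Complex.imLm.compMultilinearMap (L.restrict A)

/-- The polynomial `P z = A (z, …, z)` on `E` is regular: `A` is its symmetric form, and its real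
and imaginary parts are regular on `X`. -/
def IsRegular (A : MultilinearMap ℂ (fun _ : Fin m => E) ℂ) : Prop :=
  IsSymmForm A ∧ IsRegularReal (L.reForm A) ∧ IsRegularReal (L.imForm A)

/-- `M` is (the complexification of) the absolute value `|P| = sup_θ (P₀ cos θ + P₁ sin θ)` of
`P = P₀ + i P₁`, the supremum being taken in the ordered space of real homogeneous polynomials.
There is at most one such `M`. -/
def IsAbsForm (A M : MultilinearMap ℂ (fun _ : Fin m => E) ℂ) : Prop :=
  IsSymmForm M ∧ L.imForm M = 0 ∧
  (∀ θ : ℝ, FormLE (Real.cos θ • L.reForm A + Real.sin θ • L.imForm A) (L.reForm M)) ∧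
  ∀ B : MultilinearMap ℝ (fun _ : Fin m => X) ℝ, IsSymmForm B →
    (∀ θ : ℝ, FormLE (Real.cos θ • L.reForm A + Real.sin θ • L.imForm A) B) →
    FormLE (L.reForm M) B

/-- The regular norm `‖P‖_r = ‖ |P| ‖`; it is `∞` if `P` has no absolute value. (The absolute value
is unique, so that the infimum runs over at most one element.) -/
noncomputable def regNorm (A : MultilinearMap ℂ (fun _ : Fin m => E) ℂ) : ℝ≥0∞ :=
  ⨅ M : MultilinearMap ℂ (fun _ : Fin m => E) ℂ, ⨅ _ : L.IsAbsForm A M, supNorm M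

/-- The power series `∑ P_m` is regularly convergent at `w`: the series `∑ |P_m|(|w|)` converges. -/
def RegularlyConvergentAt (P : ∀ m : ℕ, MultilinearMap ℂ (fun _ : Fin m => E) ℂ) (w : E) : Prop :=
  ∃ M : ∀ m : ℕ, MultilinearMap ℂ (fun _ : Fin m => E) ℂ,
    (∀ m, L.IsAbsForm (P m) (M m)) ∧ Summable fun m => M m (fun _ => L.ofReal (L.abs w))

/-- `f` is regularly holomorphic on the open set `U`: it is holomorphic, its derivatives at the
points of `U` are regular, and its Taylor series at each point `z` of `U` is regularly convergent
in some neighbourhood of `z`. -/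
def RegularlyHolomorphicOn (f : E → ℂ) (U : Set E) : Prop :=
  AnalyticOnNhd ℂ f U ∧
  (∀ z ∈ U, ∀ m : ℕ, L.IsRegular (taylorForm f z m)) ∧
  ∀ z ∈ U, ∃ δ : ℝ, 0 < δ ∧ ∀ w : E, ‖w‖ < δ → L.RegularlyConvergentAt (taylorForm f z) w

/-- The radius of regular convergence `|r|(f, a) = (limsup ‖P_m‖_r^{1/m})⁻¹`. -/
noncomputable def regConvRadius (f : E → ℂ) (a : E) : ℝ≥0∞ :=
  (limsup (fun m : ℕ => L.regNorm (taylorForm f a m) ^ (1 / (m : ℝ))) atTop)⁻¹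

/-- The `m`-th Bohr radius `K_m(B_E)`: the supremum of the `ρ ≥ 0` such that
`ρ^m ‖P‖_r ≤ ‖P‖` for all regular `m`-homogeneous polynomials `P` on `E`. -/
noncomputable def bohrRadius (m : ℕ) : ℝ≥0∞ :=
  ⨆ ρ : ℝ≥0, ⨆ _ : ∀ A : MultilinearMap ℂ (fun _ : Fin m => E) ℂ, L.IsRegular A →
    (ρ : ℝ≥0∞) ^ m * L.regNorm A ≤ supNorm A, (ρ : ℝ≥0∞)

end ComplexBanachLattice

/-! A form `B` on `X` dominates `A` if `|A x| ≤ B x` on tuples of nonnegative vectors; the absolute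
value of `A` is its least dominating form (`forall_formLE_iff`). Three facts about domination carry
the proof. It extends to all vectors, `|A z| ≤ B |z|`: lattice versions of hat functions write `z =
∑ c_p h_p` with `h_p ≥ 0`, `∑ h_p = |z|` and `|c_p| ≤ 1 + ε` (`exists_sum_smul_ofReal`), and `A z`
is expanded along these sums. Regular forms have an absolute value (`exists_isAbsForm`): one
variable at a time, `|A x|` is replaced by the supremum of its sums over partitions of that
variable. Positive forms are bounded, with polarization constant at most `m^m / m! ≤ e^m`
(`IsAbsForm.reForm_apply_le`).

The two inequalities follow degree by degree from `‖P‖ ≤ ‖P‖_r` and `K_m ‖P‖_r^{1/m} ≤ ‖P‖^{1/m}`,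
since a liminf times a limsup is at most the limsup of the product.

For sharpness, every ratio `τ > 0` with `κ ≤ τ ≤ 1` is attained. In infinitely many degrees take a
polynomial nearly extremal for the Bohr radius, with `‖P‖_r = 1` and `‖P‖^{1/m}` at most slightly
above `τ`; in the other degrees take `τ^m ξ^m` with `ξ` a positive functional of norm one. The
limsups of the roots are `1` and `τ` (`exists_extremal_forms`). Rescaling the variable makes the
series converge on a ball around `a` containing `V`. It is regular at the other points `a + b`
because moving the origin to `b` preserves domination if the dominating series is moved to `|b|`
(`norm_changeOrigin_le`). -/

set_option linter.unusedSectionVars false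

/-! ### Inequalities in vector lattices -/

section VectorLattice

variable {X : Type*} [AddCommGroup X] [Lattice X] [IsOrderedAddMonoid X]

/-- The infimum is supermodular. -/
theorem inf_sub_inf_mono {a a' b b' : X} (ha : a ≤ a') (hb : b ≤ b') :
    a ⊓ b' - a ⊓ b ≤ a' ⊓ b' - a' ⊓ b := by
  -- In this form the increment is visibly monotone in `c`.
  have key : ∀ c : X, c ⊓ b' - c ⊓ b = (c ⊓ b') ⊔ b - b := by
    intro c
    have h := inf_add_sup (c ⊓ b') b
    rw [inf_assoc, inf_eq_right.2 hb] at h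
    rw [sub_eq_sub_iff_add_eq_add, ← h, add_comm]
  rw [key, key]
  gcongr

theorem posPart_inf_eq_sub (w u : X) (hu : 0 ≤ u) : w⁺ ⊓ u = w⁺ - (w - u)⁺ := by
  have h1 : w⁺ ⊓ u = w⁺ - (w⁺ - u)⁺ := by rw [inf_eq_sub_posPart_sub]
  have h2 : (w⁺ - u)⁺ = (w - u)⁺ := by
    rw [posPart_def, posPart_def, posPart_def, sup_sub, sup_assoc, zero_sub,
      sup_eq_right.2 (neg_nonpos.2 hu)]
  rw [h1, h2]

theorem le_posPart_inf {a b c : X} (hb : a ≤ b⁺) (hc : a ≤ c⁺) : a ≤ (b ⊓ c)⁺ := by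
  let := AddCommGroup.toDistribLattice X
  rw [posPart_def, sup_inf_right]
  exact le_inf hb hc

theorem add_nonneg_of_abs_le {s u : X} (hs : |s| ≤ u) : 0 ≤ s + u := by
  have := add_le_add_right (abs_le'.1 hs).2 s
  rwa [add_neg_cancel] at this

end VectorLattice

/-! ### Hat functions of a grid in lattice terms -/

section Hat

variable {X : Type*} [AddCommGroup X] [Lattice X] [IsOrderedAddMonoid X]
  [Module ℝ X] [IsOrderedModule ℝ X]

theorem smul_le_abs_of_abs_le_one {t : ℝ} (ht : |t| ≤ 1) (v : X) : t • v ≤ |v| := by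
  have key : ∀ r : ℝ, 0 ≤ r → r ≤ 1 → ∀ w : X, r • w ≤ |w| := fun r h0 h1 w =>
    (smul_le_smul_of_nonneg_left (le_abs_self w) h0).trans
      (smul_le_of_le_one_left (abs_nonneg w) h1)
  rcases le_total 0 t with h | h
  · exact key t h ((le_abs_self t).trans ht) v
  · simpa using key (-t) (neg_nonneg.2 h) ((neg_le_abs t).trans ht) (-v)

/-- The multiple `T k` of `u` obtained by cutting off `N s + (N + 1 - k) u` at `0` and `u`. -/
noncomputable def cutoff (N : ℕ) (s u : X) (k : ℕ) : X :=
  ((N : ℝ) • s + ((N : ℝ) + 1 - k) • u)⁺ ⊓ u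

variable {N : ℕ} {s u : X}

theorem cutoff_nonneg (hu : 0 ≤ u) (k : ℕ) : 0 ≤ cutoff N s u k :=
  le_inf (posPart_nonneg _) hu

theorem cutoff_le (k : ℕ) : cutoff N s u k ≤ u := inf_le_right

theorem cutoff_succ_le (hu : 0 ≤ u) (k : ℕ) : cutoff N s u (k + 1) ≤ cutoff N s u k := by
  unfold cutoff
  apply inf_le_inf_right
  apply posPart_mono
  gcongr
  linarith

theorem cutoff_zero (hs : |s| ≤ u) : cutoff N s u 0 = u := by
  unfold cutoff
  refine inf_eq_right.2 (le_trans ?_ (le_posPart _))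
  have h : 0 ≤ (N : ℝ) • (s + u) := smul_nonneg (by positivity) (add_nonneg_of_abs_le hs)
  calc u ≤ (N : ℝ) • (s + u) + u := le_add_of_nonneg_left h
    _ = _ := by push_cast; module

theorem cutoff_last (hs : |s| ≤ u) : cutoff N s u (2 * N + 1) = 0 := by
  have hu : 0 ≤ u := (abs_nonneg s).trans hs
  unfold cutoff
  have h : (N : ℝ) • s + ((N : ℝ) + 1 - ((2 * N + 1 : ℕ) : ℝ)) • u ≤ 0 := by
    have h : (N : ℝ) • (s - u) ≤ 0 :=
      smul_nonpos_of_nonneg_of_nonpos (by positivity) (sub_nonpos.2 ((le_abs_self s).trans hs))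
    refine le_trans (le_of_eq ?_) h
    push_cast; module
  rw [posPart_eq_zero.2 h]
  exact inf_eq_left.2 hu

/-- Clipping to `[0, u]` is a difference of consecutive positive parts, so sums of cutoffs
telescope. -/
theorem cutoff_eq_sub (hu : 0 ≤ u) (k : ℕ) :
    cutoff N s u k = ((N : ℝ) • s + ((N : ℝ) + 1 - k) • u)⁺ -
      ((N : ℝ) • s + ((N : ℝ) + 1 - (k + 1 : ℕ)) • u)⁺ := by
  rw [cutoff, posPart_inf_eq_sub _ _ hu]
  congr 2
  push_cast
  module

/-- The differences of consecutive cutoffs are the one-dimensional hats, centred where `N s = (k -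
N) u`; piecewise linear interpolation reproduces the linear function `s`. -/
theorem sum_smul_cutoff_sub (hs : |s| ≤ u) :
    ∑ k ∈ Finset.range (2 * N + 1), ((k : ℝ) - N) • (cutoff N s u k - cutoff N s u (k + 1)) =
      (N : ℝ) • s := by
  have hu : 0 ≤ u := (abs_nonneg s).trans hs
  -- Summation by parts; at `n = 2N + 1` the last cutoff and the second positive part vanish.
  have abel_sum : ∀ n : ℕ, ∑ k ∈ Finset.range n,
      ((k : ℝ) - N) • (cutoff N s u k - cutoff N s u (k + 1)) =
      ((N : ℝ) • s + ((N : ℝ) + 1) • u)⁺ -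
        ((N : ℝ) • s + ((N : ℝ) + 1 - n) • u)⁺
      - ((N : ℝ) + 1) • cutoff N s u 0 - ((n : ℝ) - N - 1) • cutoff N s u n := by
    intro n
    induction n with
    | zero => simp only [Finset.range_zero, Finset.sum_empty, Nat.cast_zero, sub_zero]; module
    | succ n ih =>
      rw [Finset.sum_range_succ, ih]
      have := cutoff_eq_sub (N := N) (s := s) hu n
      rw [eq_sub_iff_add_eq'] at this
      rw [← this]
      push_cast
      module
  rw [abel_sum, cutoff_last hs, cutoff_zero hs]
  have h1 : 0 ≤ (N : ℝ) • s + ((N : ℝ) + 1) • u := by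
    have : 0 ≤ (N : ℝ) • (s + u) + u :=
      add_nonneg (smul_nonneg (by positivity) (add_nonneg_of_abs_le hs)) hu
    refine this.trans_eq (by module)
  have h2 : (N : ℝ) • s + ((N : ℝ) + 1 - ((2 * N + 1 : ℕ) : ℝ)) • u ≤ 0 := by
    have h : (N : ℝ) • (s - u) ≤ 0 :=
      smul_nonpos_of_nonneg_of_nonpos (by positivity) (sub_nonpos.2 ((le_abs_self s).trans hs))
    refine le_trans (le_of_eq ?_) h
    push_cast; module
  rw [posPart_eq_self.2 h1, posPart_eq_zero.2 h2]
  module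

/-- For real functions with `u = 1` both sides are the same hat; this bound localizes its support.
-/
theorem cutoff_sub_le (hu : 0 ≤ u) (k : ℕ) :
    cutoff N s u k - cutoff N s u (k + 1) ≤ (u - |(N : ℝ) • s + ((N : ℝ) - k) • u|)⁺ := by
  set w : X := (N : ℝ) • s + ((N : ℝ) - k) • u with hw
  have e1 : cutoff N s u k = (w + u)⁺ ⊓ u := by
    rw [cutoff, hw]; congr 2; module
  have e2 : cutoff N s u (k + 1) = w⁺ ⊓ u := by
    rw [cutoff, hw]; congr 3; push_cast; module
  have h1 : cutoff N s u k - cutoff N s u (k + 1) ≤ (u - w)⁺ := by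
    have : u ≤ (w⁺ ⊓ u) + (u - w)⁺ := by
      have h : u ⊓ w + (u - w)⁺ = u := by rw [inf_eq_sub_posPart_sub]; abel
      calc u = u ⊓ w + (u - w)⁺ := h.symm
        _ ≤ _ := by
          rw [inf_comm]
          gcongr
          exact le_posPart w
    rw [e1, e2, sub_le_iff_le_add']
    exact inf_le_right.trans this
  have h2 : cutoff N s u k - cutoff N s u (k + 1) ≤ (u + w)⁺ := by
    have := cutoff_nonneg (N := N) (s := s) hu (k + 1)
    refine (sub_le_self _ this).trans ?_
    rw [e1, add_comm]
    exact inf_le_left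
  have h3 : u - |w| = (u - w) ⊓ (u + w) := by
    rw [abs, sub_sup, sub_neg_eq_add]
  rw [h3]
  exact le_posPart_inf h1 h2

/-- The hat functions of a square grid, evaluated at `(x / u, y / u)` and multiplied by `u`. -/
noncomputable def gridHat (N : ℕ) (x y u : X) (p : ℕ × ℕ) : X :=
  (cutoff N x u p.1 ⊓ cutoff N y u p.2 - cutoff N x u p.1 ⊓ cutoff N y u (p.2 + 1)) -
    (cutoff N x u (p.1 + 1) ⊓ cutoff N y u p.2 - cutoff N x u (p.1 + 1) ⊓ cutoff N y u (p.2 + 1))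

variable {x y : X}

/-- Without products, the two partitions of `u` are coupled by the infimum: its four-corner
differences are nonnegative by supermodularity. -/
theorem gridHat_nonneg (hu : 0 ≤ u) (p : ℕ × ℕ) : 0 ≤ gridHat N x y u p :=
  sub_nonneg.2 (inf_sub_inf_mono (cutoff_succ_le hu _) (cutoff_succ_le hu _))

/-- Telescoping leaves infima with `u` and with `0`, so the marginals of the coupling are the
one-dimensional hats. -/
theorem sum_gridHat_right (hy : |y| ≤ u) (k : ℕ) :
    ∑ l ∈ Finset.range (2 * N + 1), gridHat N x y u (k, l) =
      cutoff N x u k - cutoff N x u (k + 1) := by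
  have hu : 0 ≤ u := (abs_nonneg y).trans hy
  simp only [gridHat]
  rw [Finset.sum_sub_distrib, Finset.sum_range_sub', Finset.sum_range_sub', cutoff_zero hy,
    cutoff_last hy]
  simp only [inf_eq_left.2 (cutoff_le _), inf_eq_right.2 (cutoff_nonneg hu _), sub_zero]

theorem gridHat_swap (k l : ℕ) : gridHat N x y u (k, l) = gridHat N y x u (l, k) := by
  simp only [gridHat, inf_comm (cutoff N x u _)]
  abel

theorem sum_gridHat_left (hx : |x| ≤ u) (l : ℕ) :
    ∑ k ∈ Finset.range (2 * N + 1), gridHat N x y u (k, l) =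
      cutoff N y u l - cutoff N y u (l + 1) := by
  simp only [gridHat_swap _ l]
  exact sum_gridHat_right hx l

theorem gridHat_le_left (hy : |y| ≤ u) {k l : ℕ} (hl : l < 2 * N + 1) :
    gridHat N x y u (k, l) ≤ cutoff N x u k - cutoff N x u (k + 1) := by
  have hu : 0 ≤ u := (abs_nonneg y).trans hy
  rw [← sum_gridHat_right hy]
  exact Finset.single_le_sum (f := fun l => gridHat N x y u (k, l))
    (fun _ _ => gridHat_nonneg hu _) (Finset.mem_range.2 hl)

theorem sum_gridHat (hx : |x| ≤ u) (hy : |y| ≤ u) :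
    ∑ p ∈ Finset.range (2 * N + 1) ×ˢ Finset.range (2 * N + 1), gridHat N x y u p = u := by
  rw [Finset.sum_product]
  simp only [sum_gridHat_right hy]
  rw [Finset.sum_range_sub', cutoff_zero hx, cutoff_last hx, sub_zero]

theorem sum_smul_gridHat_left (hx : |x| ≤ u) (hy : |y| ≤ u) :
    ∑ p ∈ Finset.range (2 * N + 1) ×ˢ Finset.range (2 * N + 1),
      ((p.1 : ℝ) - N) • gridHat N x y u p = (N : ℝ) • x := by
  rw [Finset.sum_product]
  simp only [← Finset.smul_sum, sum_gridHat_right hy]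
  exact sum_smul_cutoff_sub hx

theorem sum_smul_gridHat_right (hx : |x| ≤ u) (hy : |y| ≤ u) :
    ∑ p ∈ Finset.range (2 * N + 1) ×ˢ Finset.range (2 * N + 1),
      ((p.2 : ℝ) - N) • gridHat N x y u p = (N : ℝ) • y := by
  rw [Finset.sum_product_right]
  simp only [← Finset.smul_sum, sum_gridHat_left hx]
  exact sum_smul_cutoff_sub hy

/-- The hat function of a grid point that is far outside the unit disc vanishes. -/
theorem gridHat_eq_zero (hu : ∀ θ : ℝ, Real.cos θ • x + Real.sin θ • y ≤ u)
    (hx : |x| ≤ u) (hy : |y| ≤ u) {p : ℕ × ℕ} (hp1 : p.1 < 2 * N + 1) (hp2 : p.2 < 2 * N + 1)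
    (hp : (N : ℝ) + 2 ≤ ‖(⟨(p.1 : ℝ) - N, (p.2 : ℝ) - N⟩ : ℂ)‖) :
    gridHat N x y u p = 0 := by
  obtain ⟨k, l⟩ := p
  simp only at hp1 hp2 hp
  have hu0 : 0 ≤ u := (abs_nonneg x).trans hx
  refine le_antisymm ?_ (gridHat_nonneg hu0 _)
  set c : ℂ := ⟨(k : ℝ) - N, (l : ℝ) - N⟩ with hc
  set w := (N : ℝ) • x + ((N : ℝ) - k) • u with hw
  set w' := (N : ℝ) • y + ((N : ℝ) - l) • u with hw'
  have h1 : gridHat N x y u (k, l) ≤ (u - |w|)⁺ :=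
    (gridHat_le_left hy hp2).trans (cutoff_sub_le hu0 k)
  have h2 : gridHat N x y u (k, l) ≤ (u - |w'|)⁺ := by
    rw [gridHat_swap]
    exact (gridHat_le_left hx hp1).trans (cutoff_sub_le hu0 l)
  have h3 : gridHat N x y u (k, l) ≤ (u - |w| ⊔ |w'|)⁺ := by
    rw [sub_sup]; exact le_posPart_inf h1 h2
  refine h3.trans (posPart_nonpos.2 (sub_nonpos.2 ?_))
  -- In the direction of the grid point, `N z` falls short of it by at least `2u`, so one of the two
  -- coordinates is off by at least `u`.
  set θ := Complex.arg c
  have hre : ‖c‖ * Real.cos θ = (k : ℝ) - N := Complex.norm_mul_cos_arg c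
  have him : ‖c‖ * Real.sin θ = (l : ℝ) - N := Complex.norm_mul_sin_arg c
  have e : Real.cos θ • w + Real.sin θ • w' =
      (N : ℝ) • (Real.cos θ • x + Real.sin θ • y) - ‖c‖ • u := by
    have hk : (N : ℝ) - k = -(‖c‖ * Real.cos θ) := by rw [hre]; ring
    have hl : (N : ℝ) - l = -(‖c‖ * Real.sin θ) := by rw [him]; ring
    have h : ‖c‖ • u = (‖c‖ * (Real.sin θ ^ 2 + Real.cos θ ^ 2)) • u := by
      rw [Real.sin_sq_add_cos_sq, mul_one]
    rw [hw, hw', hk, hl, h]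
    module
  have e2 : Real.cos θ • w + Real.sin θ • w' ≤ -((2 : ℝ) • u) := by
    rw [e]
    have a1 : (N : ℝ) • (Real.cos θ • x + Real.sin θ • y) ≤ (N : ℝ) • u := by
      gcongr; exact hu θ
    have a2 : ((N : ℝ) + 2) • u ≤ ‖c‖ • u := by gcongr
    calc _ ≤ (N : ℝ) • u - ((N : ℝ) + 2) • u := sub_le_sub a1 a2
      _ = _ := by module
  have smul_ge : ∀ (t : ℝ) (v : X), |t| ≤ 1 → -|v| ≤ t • v := by
    intro t v ht
    rw [neg_le, ← neg_smul]
    exact smul_le_abs_of_abs_le_one (by rwa [abs_neg]) v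
  have e3 : (2 : ℝ) • u ≤ (2 : ℝ) • (|w| ⊔ |w'|) := by
    have b1 := smul_ge _ w (Real.abs_cos_le_one θ)
    have b2 := smul_ge _ w' (Real.abs_sin_le_one θ)
    have := (add_le_add b1 b2).trans e2
    rw [le_neg] at this
    refine this.trans ?_
    rw [two_smul, neg_add, neg_neg, neg_neg]
    exact add_le_add le_sup_left le_sup_right
  exact le_of_smul_le_smul_left e3 two_pos

end Hat

/-! ### Decomposition of complex vectors and domination of forms -/

namespace ComplexBanachLattice

variable {X E : Type*}
  [NormedAddCommGroup X] [Lattice X] [IsOrderedAddMonoid X] [HasSolidNorm X]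
  [NormedSpace ℝ X] [IsOrderedModule ℝ X] [CompleteSpace X]
  [NormedAddCommGroup E] [NormedSpace ℂ E]
  (L : ComplexBanachLattice X E) {m : ℕ}

theorem cos_smul_add_sin_smul_le_abs (z : E) (θ : ℝ) :
    Real.cos θ • L.re z + Real.sin θ • L.im z ≤ L.abs z :=
  (L.isLUB_abs z).1 ⟨θ, rfl⟩

theorem abs_re_le_abs (z : E) : |L.re z| ≤ L.abs z := by
  refine abs_le'.2 ⟨?_, ?_⟩
  · simpa using L.cos_smul_add_sin_smul_le_abs z 0
  · simpa using L.cos_smul_add_sin_smul_le_abs z Real.pi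

theorem abs_im_le_abs (z : E) : |L.im z| ≤ L.abs z := by
  refine abs_le'.2 ⟨?_, ?_⟩
  · simpa using L.cos_smul_add_sin_smul_le_abs z (Real.pi / 2)
  · simpa using L.cos_smul_add_sin_smul_le_abs z (-(Real.pi / 2))

theorem abs_nonneg (z : E) : 0 ≤ L.abs z := (_root_.abs_nonneg _).trans (L.abs_re_le_abs z)

theorem re_im_eq {z : E} {x y : X} (h : z = L.ofReal x + Complex.I • L.ofReal y) :
    L.re z = x ∧ L.im z = y :=
  L.unique_re_im _ _ _ _ ((L.re_add_im z).symm.trans h)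

theorem re_im_ofReal (x : X) : L.re (L.ofReal x) = x ∧ L.im (L.ofReal x) = 0 :=
  L.re_im_eq (by simp)

theorem abs_ofReal (x : X) : L.abs (L.ofReal x) = |x| := by
  have h := L.isLUB_abs (L.ofReal x)
  refine le_antisymm (h.2 ?_) ?_
  · rintro _ ⟨θ, rfl⟩
    simp only [L.re_im_ofReal x, smul_zero, add_zero]
    exact smul_le_abs_of_abs_le_one (Real.abs_cos_le_one θ) x
  · simpa [L.re_im_ofReal x] using L.abs_re_le_abs (L.ofReal x)

theorem abs_ofReal_of_nonneg {x : X} (hx : 0 ≤ x) : L.abs (L.ofReal x) = x := by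
  rw [abs_ofReal, abs_of_nonneg hx]

theorem norm_ofReal (x : X) : ‖L.ofReal x‖ = ‖x‖ := by
  rw [L.norm_eq, abs_ofReal, norm_abs_eq_norm]

/-- Every vector is a finite combination of positive vectors that sum up to its modulus, with
coefficients of modulus at most `1 + ε`. -/
theorem exists_sum_smul_ofReal (z : E) {ε : ℝ} (hε : 0 < ε) :
    ∃ (s : Finset (ℕ × ℕ)) (c : ℕ × ℕ → ℂ) (h : ℕ × ℕ → X), (∀ p, 0 ≤ h p) ∧
      (∀ p ∈ s, ‖c p‖ ≤ 1 + ε) ∧ z = ∑ p ∈ s, c p • L.ofReal (h p) ∧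
      ∑ p ∈ s, h p = L.abs z := by
  -- The coefficients kept below have modulus less than `(N + 2) / N = 1 + 2 / N`.
  obtain ⟨N, hN⟩ := exists_nat_gt (2 / ε)
  have hN0 : (0 : ℝ) < N := lt_trans (by positivity) hN
  have hx := L.abs_re_le_abs z
  have hy := L.abs_im_le_abs z
  have hu := L.abs_nonneg z
  set g := gridHat N (L.re z) (L.im z) (L.abs z)
  set G := Finset.range (2 * N + 1) ×ˢ Finset.range (2 * N + 1)
  classical
  set c : ℕ × ℕ → ℂ := fun p => (⟨(p.1 : ℝ) - N, (p.2 : ℝ) - N⟩ : ℂ)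
  -- The corners of the square would give coefficients of modulus up to `√2`; their hats vanish and
  -- are dropped.
  refine ⟨G.filter fun p => ‖c p‖ < N + 2, fun p => (N : ℂ)⁻¹ * c p, g,
    fun p => gridHat_nonneg hu p, fun p hp => ?_, ?_, ?_⟩
  · have := (Finset.mem_filter.1 hp).2
    rw [norm_mul, norm_inv, Complex.norm_natCast, inv_mul_le_iff₀ hN0]
    rw [div_lt_iff₀ hε] at hN
    nlinarith
  · have vanish : ∀ p ∈ G, ¬ ‖c p‖ < N + 2 → g p = 0 := by
      intro p hp hc
      obtain ⟨h1, h2⟩ := Finset.mem_product.1 hp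
      exact gridHat_eq_zero (L.cos_smul_add_sin_smul_le_abs z) hx hy (Finset.mem_range.1 h1)
        (Finset.mem_range.1 h2) (not_lt.1 hc)
    rw [Finset.sum_filter_of_ne]
    · have e1 := congrArg L.ofReal (sum_smul_gridHat_left (N := N) hx hy)
      have e2 := congrArg L.ofReal (sum_smul_gridHat_right (N := N) hx hy)
      rw [map_sum] at e1 e2
      simp only [map_smul] at e1 e2
      have e3 : ∀ p, ((N : ℂ)⁻¹ * c p) • L.ofReal (g p) =
          (N : ℂ)⁻¹ • ((((p.1 : ℝ) - N) • L.ofReal (g p)) +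
            Complex.I • (((p.2 : ℝ) - N) • L.ofReal (g p))) := by
        intro p
        have : c p = (((p.1 : ℝ) - N : ℝ) : ℂ) + Complex.I * (((p.2 : ℝ) - N : ℝ) : ℂ) := by
          apply Complex.ext <;> simp [c]
        rw [this, mul_smul, add_smul, mul_smul, Complex.coe_smul, Complex.coe_smul]
      simp only [e3]
      rw [← Finset.smul_sum, Finset.sum_add_distrib, ← Finset.smul_sum, e1, e2,
        ← Complex.coe_smul, ← Complex.coe_smul, smul_comm Complex.I, ← smul_add, ← L.re_add_im z,
        smul_smul, Complex.ofReal_natCast, inv_mul_cancel₀, one_smul]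
      exact_mod_cast hN0.ne'
    · intro p hp hne
      by_contra hc
      exact hne (by rw [vanish p hp hc]; simp)
  · rw [Finset.sum_filter_of_ne]
    · exact sum_gridHat hx hy
    · intro p hp hne
      by_contra hc
      obtain ⟨h1, h2⟩ := Finset.mem_product.1 hp
      exact hne (gridHat_eq_zero (L.cos_smul_add_sin_smul_le_abs z) hx hy (Finset.mem_range.1 h1)
        (Finset.mem_range.1 h2) (not_lt.1 hc))

/-- A complex form that is dominated by a real form on positive vectors is dominated everywhere. -/
theorem norm_apply_le_of_le_on_nonneg {A : MultilinearMap ℂ (fun _ : Fin m => E) ℂ}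
    {B : MultilinearMap ℝ (fun _ : Fin m => X) ℝ}
    (h : ∀ x : Fin m → X, (∀ i, 0 ≤ x i) → ‖A fun i => L.ofReal (x i)‖ ≤ B x) (z : Fin m → E) :
    ‖A z‖ ≤ B fun i => L.abs (z i) := by
  have key : ∀ ε : ℝ, 0 < ε → ‖A z‖ ≤ (1 + ε) ^ m * B fun i => L.abs (z i) := by
    intro ε hε
    choose s c g hg hc hz hs using fun i => L.exists_sum_smul_ofReal (z i) hε
    have e1 : A z = ∑ r ∈ Fintype.piFinset s,
        (∏ i, c i (r i)) • A fun i => L.ofReal (g i (r i)) := by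
      rw [show z = fun i => ∑ p ∈ s i, c i p • L.ofReal (g i p) from funext hz,
        A.map_sum_finset]
      exact Finset.sum_congr rfl fun r _ => A.map_smul_univ _ _
    -- The same positive pieces sum to the moduli, so `B` reassembles without loss.
    have e2 : (B fun i => L.abs (z i)) = ∑ r ∈ Fintype.piFinset s, B fun i => g i (r i) := by
      rw [← B.map_sum_finset]
      congr 1
      exact (funext hs).symm
    rw [e1, e2, Finset.mul_sum]
    refine (norm_sum_le _ _).trans (Finset.sum_le_sum fun r hr => ?_)
    rw [norm_smul, norm_prod]
    refine mul_le_mul ?_ (h _ fun i => hg i _) (norm_nonneg _) (by positivity)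
    calc ∏ i, ‖c i (r i)‖ ≤ ∏ _i : Fin m, (1 + ε) :=
          Finset.prod_le_prod (fun _ _ => norm_nonneg _) fun i _ =>
            hc i _ (Fintype.mem_piFinset.1 hr i)
      _ = (1 + ε) ^ m := by simp
  have lim : Tendsto (fun ε : ℝ => (1 + ε) ^ m * B fun i => L.abs (z i))
      (nhdsWithin 0 (Set.Ioi 0)) (nhds ((1 + 0) ^ m * B fun i => L.abs (z i))) := by
    refine Tendsto.mono_left (Continuous.tendsto ?_ _) nhdsWithin_le_nhds
    fun_prop
  have := ge_of_tendsto lim (eventually_mem_nhdsWithin.mono fun ε hε => key ε hε)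
  simpa using this

/-- A complex form is determined by its values on positive vectors. -/
theorem ext_of_nonneg {A A' : MultilinearMap ℂ (fun _ : Fin m => E) ℂ}
    (h : ∀ x : Fin m → X, (∀ i, 0 ≤ x i) →
      (A fun i => L.ofReal (x i)) = A' fun i => L.ofReal (x i)) : A = A' := by
  refine MultilinearMap.ext fun z => ?_
  have := L.norm_apply_le_of_le_on_nonneg (A := A - A') (B := 0)
    (fun x hx => by simp [h x hx]) z
  simpa [sub_eq_zero] using this

end ComplexBanachLattice

/-! ### Least additive majorants in one variable -/

section AdditiveHull

variable {X : Type*} [AddCommGroup X] [Lattice X] [IsOrderedAddMonoid X]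

/-- The Riesz decomposition property, with witness `h ⊓ u`. -/
theorem exists_add_eq_of_add_eq_add {h t u v : X} (hh : 0 ≤ h) (ht : 0 ≤ t) (hu : 0 ≤ u)
    (hv : 0 ≤ v) (e : h + t = u + v) :
    ∃ a b : X, 0 ≤ a ∧ 0 ≤ b ∧ a + b = h ∧ a ≤ u ∧ b ≤ v := by
  refine ⟨h ⊓ u, h - h ⊓ u, le_inf hh hu, sub_nonneg.2 inf_le_left, by abel, inf_le_right, ?_⟩
  rw [inf_eq_sub_posPart_sub, sub_sub_cancel, posPart_def]
  refine sup_le ?_ hv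
  have : h - u = v - t := by rw [sub_eq_sub_iff_add_eq_add, e, add_comm]
  rw [this]
  exact sub_le_self _ ht

/-- Subadditivity on the positive cone, with a nonpositive value at the origin. -/
structure IsSubadditiveOnCone (g : X → ℝ) : Prop where
  map_zero_le : g 0 ≤ 0
  map_add_le : ∀ u v : X, 0 ≤ u → 0 ≤ v → g (u + v) ≤ g u + g v

theorem IsSubadditiveOnCone.map_list_sum_le {g : X → ℝ} (hg : IsSubadditiveOnCone g) :
    ∀ l : List X, (∀ y ∈ l, 0 ≤ y) → g l.sum ≤ (l.map g).sum
  | [], _ => by simpa using hg.map_zero_le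
  | y :: l, h => by
    have h0 : ∀ y ∈ l, 0 ≤ y := fun z hz => h z (List.mem_cons_of_mem _ hz)
    simp only [List.sum_cons, List.map_cons]
    refine (hg.map_add_le _ _ (h y (by simp)) (List.sum_nonneg h0)).trans ?_
    gcongr
    exact hg.map_list_sum_le l h0

/-- Each piece is split by Riesz decomposition. The lists do not depend on `g`, so one splitting
serves several functions at once. -/
theorem exists_list_split : ∀ (l : List X), (∀ y ∈ l, 0 ≤ y) → ∀ u v : X, 0 ≤ u → 0 ≤ v →
    l.sum = u + v → ∃ lu lv : List X, (∀ y ∈ lu, 0 ≤ y) ∧ (∀ y ∈ lv, 0 ≤ y) ∧ lu.sum = u ∧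
      lv.sum = v ∧ ∀ g : X → ℝ, IsSubadditiveOnCone g →
        (l.map g).sum ≤ (lu.map g).sum + (lv.map g).sum
  | [], _, u, v, hu, hv, e => by
    have h := (add_eq_zero_iff_of_nonneg hu hv).1 e.symm
    exact ⟨[], [], by simp, by simp, h.1.symm, h.2.symm, by simp⟩
  | y :: l, h, u, v, hu, hv, e => by
    have h0 : ∀ y ∈ l, 0 ≤ y := fun z hz => h z (List.mem_cons_of_mem _ hz)
    have hy : 0 ≤ y := h y (by simp)
    rw [List.sum_cons] at e
    obtain ⟨a, b, ha, hb, hab, hau, hbv⟩ :=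
      exists_add_eq_of_add_eq_add hy (List.sum_nonneg h0) hu hv e
    have e' : l.sum = (u - a) + (v - b) := by
      rw [← hab] at e
      rw [sub_add_sub_comm, ← e]
      abel
    obtain ⟨lu, lv, h1, h2, h3, h4, h5⟩ :=
      exists_list_split l h0 (u - a) (v - b) (sub_nonneg.2 hau) (sub_nonneg.2 hbv) e'
    refine ⟨a :: lu, b :: lv, by simpa [ha] using h1, by simpa [hb] using h2, by simp [h3],
      by simp [h4], fun g hg => ?_⟩
    simp only [List.map_cons, List.sum_cons]
    have := hg.map_add_le a b ha hb
    rw [hab] at this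
    linarith [h5 g hg]

/-- Two partitions of a vector have a common refinement, and refining only increases the sums of a
subadditive function. -/
theorem exists_list_refinement : ∀ (l : List X), (∀ y ∈ l, 0 ≤ y) → ∀ l' : List X,
    (∀ y ∈ l', 0 ≤ y) → l.sum = l'.sum → ∃ k : List X, (∀ y ∈ k, 0 ≤ y) ∧ k.sum = l.sum ∧
      ∀ g : X → ℝ, IsSubadditiveOnCone g →
        (l.map g).sum ≤ (k.map g).sum ∧ (l'.map g).sum ≤ (k.map g).sum
  | [], _, l', h', e => by
    refine ⟨l', h', e.symm, fun g hg => ⟨?_, le_rfl⟩⟩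
    have h0 : ∀ y ∈ l', y = 0 := fun y hy => by
      refine le_antisymm ?_ (h' y hy)
      have := List.single_le_sum h' y hy
      rwa [← e] at this
    have e2 := hg.map_add_le 0 0 le_rfl le_rfl
    have e3 : g 0 = 0 := le_antisymm hg.map_zero_le (by rw [add_zero] at e2; linarith)
    simp only [List.map_nil, List.sum_nil]
    refine List.sum_nonneg fun r hr => ?_
    obtain ⟨y, hy, rfl⟩ := List.mem_map.1 hr
    rw [h0 y hy, e3]
  | y :: l, h, l', h', e => by
    have h0 : ∀ y ∈ l, 0 ≤ y := fun z hz => h z (List.mem_cons_of_mem _ hz)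
    have hy : 0 ≤ y := h y (by simp)
    rw [List.sum_cons] at e
    obtain ⟨a, b, h1, h2, h3, h4, h5⟩ :=
      exists_list_split l' h' y l.sum hy (List.sum_nonneg h0) e.symm
    obtain ⟨k, k1, k2, k3⟩ := exists_list_refinement l h0 b h2 h4.symm
    refine ⟨a ++ k, ?_, by simp [h3, k2], fun g hg => ⟨?_, ?_⟩⟩
    · intro z hz
      rcases List.mem_append.1 hz with hz | hz
      exacts [h1 z hz, k1 z hz]
    · have := hg.map_list_sum_le a h1
      rw [h3] at this
      simp only [List.map_cons, List.sum_cons, List.map_append, List.sum_append]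
      linarith [(k3 g hg).1]
    · simp only [List.map_append, List.sum_append]
      linarith [(k3 g hg).2, h5 g hg]

/-- The sums of `g` over the partitions of `x` into positive vectors. -/
def partitionSums (g : X → ℝ) (x : X) : Set ℝ :=
  {r | ∃ l : List X, (∀ y ∈ l, 0 ≤ y) ∧ l.sum = x ∧ (l.map g).sum = r}

/-- The least additive majorant of a subadditive function on the positive cone. -/
noncomputable def additiveHull (g : X → ℝ) (x : X) : ℝ := sSup (partitionSums g x)

variable {g g₁ g₂ : X → ℝ} {x u v : X}

theorem partitionSums_nonempty (hx : 0 ≤ x) : (partitionSums g x).Nonempty :=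
  ⟨_, [x], by simpa using hx, by simp, rfl⟩

theorem le_additiveHull_self (hb : BddAbove (partitionSums g x)) (hx : 0 ≤ x) :
    g x ≤ additiveHull g x :=
  le_csSup hb ⟨[x], by simpa using hx, by simp, by simp⟩

theorem additiveHull_add (hg : IsSubadditiveOnCone g) (hu : 0 ≤ u) (hv : 0 ≤ v)
    (hbu : BddAbove (partitionSums g u)) (hbv : BddAbove (partitionSums g v))
    (hb : BddAbove (partitionSums g (u + v))) :
    additiveHull g (u + v) = additiveHull g u + additiveHull g v := by
  refine le_antisymm ?_ ?_
  · refine csSup_le (partitionSums_nonempty (add_nonneg hu hv)) ?_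
    rintro _ ⟨l, h1, h2, rfl⟩
    obtain ⟨a, b, a1, b1, a2, b2, h⟩ := exists_list_split l h1 u v hu hv h2
    exact (h g hg).trans
      (add_le_add (le_csSup hbu ⟨a, a1, a2, rfl⟩) (le_csSup hbv ⟨b, b1, b2, rfl⟩))
  · rw [additiveHull, additiveHull,
      ← csSup_add (partitionSums_nonempty hu) hbu (partitionSums_nonempty hv) hbv]
    refine csSup_le ((partitionSums_nonempty hu).add (partitionSums_nonempty hv)) ?_
    rintro _ ⟨_, ⟨a, a1, a2, rfl⟩, _, ⟨b, b1, b2, rfl⟩, rfl⟩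
    refine le_csSup hb ⟨a ++ b, ?_, by simp [a2, b2], by simp⟩
    intro z hz
    rcases List.mem_append.1 hz with hz | hz
    exacts [a1 z hz, b1 z hz]

theorem list_sum_map_add (l : List X) :
    (l.map fun y => g₁ y + g₂ y).sum = (l.map g₁).sum + (l.map g₂).sum := by
  induction l with
  | nil => simp
  | cons y l ih => simp only [List.map_cons, List.sum_cons, ih]; ring

theorem additiveHull_le_add (h : ∀ y, 0 ≤ y → g y ≤ g₁ y + g₂ y) (hx : 0 ≤ x)
    (hb₁ : BddAbove (partitionSums g₁ x)) (hb₂ : BddAbove (partitionSums g₂ x)) :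
    additiveHull g x ≤ additiveHull g₁ x + additiveHull g₂ x := by
  refine csSup_le (partitionSums_nonempty hx) ?_
  rintro _ ⟨l, h1, h2, rfl⟩
  refine (List.sum_le_sum (g := fun y => g₁ y + g₂ y) fun y hy => h y (h1 y hy)).trans ?_
  rw [list_sum_map_add]
  exact add_le_add (le_csSup hb₁ ⟨l, h1, h2, rfl⟩) (le_csSup hb₂ ⟨l, h1, h2, rfl⟩)

/-- Nearly optimal partitions for `g₁` and `g₂` may differ; a common refinement is good for both. -/
theorem add_le_additiveHull (h : ∀ y, 0 ≤ y → g₁ y + g₂ y ≤ g y) (hx : 0 ≤ x)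
    (hg₁ : IsSubadditiveOnCone g₁) (hg₂ : IsSubadditiveOnCone g₂)
    (hb : BddAbove (partitionSums g x))
    (hb₁ : BddAbove (partitionSums g₁ x)) (hb₂ : BddAbove (partitionSums g₂ x)) :
    additiveHull g₁ x + additiveHull g₂ x ≤ additiveHull g x := by
  rw [additiveHull, additiveHull,
    ← csSup_add (partitionSums_nonempty hx) hb₁ (partitionSums_nonempty hx) hb₂]
  refine csSup_le ((partitionSums_nonempty hx).add (partitionSums_nonempty hx)) ?_
  rintro _ ⟨_, ⟨a, a1, a2, rfl⟩, _, ⟨b, b1, b2, rfl⟩, rfl⟩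
  obtain ⟨k, k1, k2, k3⟩ := exists_list_refinement a a1 b b1 (a2.trans b2.symm)
  refine le_trans ?_ (le_csSup hb ⟨k, k1, k2.trans a2, rfl⟩)
  refine (add_le_add (k3 g₁ hg₁).1 (k3 g₂ hg₂).2).trans ?_
  rw [← list_sum_map_add]
  exact List.sum_le_sum fun y hy => h y (k1 y hy)

end AdditiveHull

/-! ### Least multiadditive majorants -/

section MultiadditiveHull

variable {X : Type*} [AddCommGroup X] [Lattice X] [IsOrderedAddMonoid X] {ι : Type*}
  [DecidableEq ι]

/-- Additivity in each variable on tuples of positive vectors. -/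
def IsMultiadditiveOnCone (G : (ι → X) → ℝ) : Prop :=
  ∀ x : ι → X, (∀ j, 0 ≤ x j) → ∀ (i : ι) (u v : X), 0 ≤ u → 0 ≤ v →
    G (Function.update x i (u + v)) = G (Function.update x i u) + G (Function.update x i v)

theorem update_nonneg_of_nonneg {x : ι → X} (hx : ∀ j, 0 ≤ x j) {i : ι} {y : X} (hy : 0 ≤ y)
    (j : ι) : 0 ≤ Function.update x i y j := by
  rcases eq_or_ne j i with rfl | h
  · simpa using hy
  · simpa [h] using hx j

theorem IsMultiadditiveOnCone.list_sum {G : (ι → X) → ℝ}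
    (hG : IsMultiadditiveOnCone G) {x : ι → X} (hx : ∀ j, 0 ≤ x j) (i : ι) (l : List X)
    (hl : ∀ y ∈ l, 0 ≤ y) :
    (l.map fun y => G (Function.update x i y)).sum = G (Function.update x i l.sum) := by
  induction l with
  | nil =>
    have := hG x hx i 0 0 le_rfl le_rfl
    rw [add_zero] at this
    simp only [List.map_nil, List.sum_nil]
    linarith
  | cons y l ih =>
    have h0 : ∀ y ∈ l, 0 ≤ y := fun z hz => hl z (List.mem_cons_of_mem _ hz)
    simp only [List.map_cons, List.sum_cons]
    rw [hG x hx i _ _ (hl y (by simp)) (List.sum_nonneg h0), ih h0]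

/-- The hull is taken in one coordinate after another. A new hull stays subadditive in the other
coordinates and, by common refinements, additive in those already treated. The majorant `G₀` keeps
the suprema finite. -/
theorem exists_partial_hull {F₀ G₀ : (ι → X) → ℝ}
    (hF₀ : ∀ x : ι → X, (∀ j, 0 ≤ x j) → ∀ i,
      IsSubadditiveOnCone fun y => F₀ (Function.update x i y))
    (hG₀ : IsMultiadditiveOnCone G₀) (hle : ∀ x : ι → X, (∀ j, 0 ≤ x j) → F₀ x ≤ G₀ x)
    (S : Finset ι) :
    ∃ F : (ι → X) → ℝ,
      (∀ x : ι → X, (∀ j, 0 ≤ x j) → ∀ i,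
        IsSubadditiveOnCone fun y => F (Function.update x i y)) ∧
      (∀ i ∈ S, ∀ x : ι → X, (∀ j, 0 ≤ x j) → ∀ u v : X, 0 ≤ u → 0 ≤ v →
        F (Function.update x i (u + v)) =
          F (Function.update x i u) + F (Function.update x i v)) ∧
      (∀ x : ι → X, (∀ j, 0 ≤ x j) → F₀ x ≤ F x) ∧
      ∀ G : (ι → X) → ℝ, IsMultiadditiveOnCone G →
        (∀ x : ι → X, (∀ j, 0 ≤ x j) → F₀ x ≤ G x) → ∀ x : ι → X, (∀ j, 0 ≤ x j) → F x ≤ G x := by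
  induction S using Finset.induction_on with
  | empty => exact ⟨F₀, hF₀, by simp, fun _ _ => le_rfl, fun G _ h => h⟩
  | insert i S _ ih =>
    obtain ⟨F, hsub, hadd, hlow, hleast⟩ := ih
    have hbound : ∀ G : (ι → X) → ℝ, IsMultiadditiveOnCone G →
        (∀ x : ι → X, (∀ j, 0 ≤ x j) → F₀ x ≤ G x) → ∀ x : ι → X, (∀ j, 0 ≤ x j) → ∀ y : X,
        ∀ r ∈ partitionSums (fun y => F (Function.update x i y)) y,
          r ≤ G (Function.update x i y) := by
      rintro G hG hG' x hx y _ ⟨l, h1, rfl, rfl⟩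
      rw [← hG.list_sum hx i l h1]
      exact List.sum_le_sum fun y hy => hleast G hG hG' _ (update_nonneg_of_nonneg hx (h1 y hy))
    have hbdd : ∀ x : ι → X, (∀ j, 0 ≤ x j) → ∀ y : X,
        BddAbove (partitionSums (fun y => F (Function.update x i y)) y) :=
      fun x hx y => ⟨_, hbound G₀ hG₀ hle x hx y⟩
    set F' : (ι → X) → ℝ := fun x => additiveHull (fun y => F (Function.update x i y)) (x i)
      with hF'
    have same : ∀ (x : ι → X) (y : X), F' (Function.update x i y) =
        additiveHull (fun y => F (Function.update x i y)) y := by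
      intro x y
      simp only [hF', Function.update_idem, Function.update_self]
    have other : ∀ (x : ι → X) (k : ι) (y : X), k ≠ i → F' (Function.update x k y) =
        additiveHull (fun y' => F (Function.update (Function.update x i y') k y)) (x i) := by
      intro x k y hk
      simp only [hF', Function.update_of_ne hk.symm]
      congr 1
      funext y'
      rw [Function.update_comm hk]
    have otherb : ∀ (x : ι → X) (k : ι) (y : X), k ≠ i → (∀ j, 0 ≤ x j) → 0 ≤ y →
        BddAbove (partitionSums
          (fun y' => F (Function.update (Function.update x i y') k y)) (x i)) := by
      intro x k y hk hx hy
      have := hbdd (Function.update x k y) (update_nonneg_of_nonneg hx hy) (x i)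
      simpa only [Function.update_comm hk] using this
    have others : ∀ (x : ι → X) (k : ι) (y : X), k ≠ i → (∀ j, 0 ≤ x j) → 0 ≤ y →
        IsSubadditiveOnCone (fun y' => F (Function.update (Function.update x i y') k y)) := by
      intro x k y hk hx hy
      have := hsub (Function.update x k y) (update_nonneg_of_nonneg hx hy) i
      simpa only [Function.update_comm hk] using this
    have addi : ∀ x : ι → X, (∀ j, 0 ≤ x j) → ∀ u v : X, 0 ≤ u → 0 ≤ v →
        F' (Function.update x i (u + v)) =
          F' (Function.update x i u) + F' (Function.update x i v) := by
      intro x hx u v hu hv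
      simp only [same]
      exact additiveHull_add (hsub x hx i) hu hv (hbdd x hx _) (hbdd x hx _) (hbdd x hx _)
    refine ⟨F', fun x hx k => ?_, fun k hk x hx u v hu hv => ?_, fun x hx => ?_,
      fun G hG hG' x hx => ?_⟩
    · rcases eq_or_ne k i with rfl | hk
      · refine ⟨?_, fun u v hu hv => (addi x hx u v hu hv).le⟩
        have := addi x hx 0 0 le_rfl le_rfl
        rw [add_zero] at this
        linarith
      · refine ⟨?_, fun u v hu hv => ?_⟩
        · rw [other x k 0 hk]
          refine csSup_le (partitionSums_nonempty (hx i)) ?_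
          rintro _ ⟨l, h1, -, rfl⟩
          refine (List.sum_le_sum (g := fun _ => (0 : ℝ)) fun y hy => ?_).trans (by simp)
          exact (hsub _ (update_nonneg_of_nonneg hx (h1 y hy)) k).map_zero_le
        · rw [other x k _ hk, other x k _ hk, other x k _ hk]
          exact additiveHull_le_add
            (fun y hy => (hsub _ (update_nonneg_of_nonneg hx hy) k).map_add_le u v hu hv) (hx i)
            (otherb x k u hk hx hu) (otherb x k v hk hx hv)
    · rcases eq_or_ne k i with rfl | hki
      · exact addi x hx u v hu hv
      · have hkS : k ∈ S := Finset.mem_of_mem_insert_of_ne hk hki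
        have e : ∀ y, 0 ≤ y → F (Function.update (Function.update x i y) k (u + v)) =
            F (Function.update (Function.update x i y) k u) +
              F (Function.update (Function.update x i y) k v) :=
          fun y hy => hadd k hkS _ (update_nonneg_of_nonneg hx hy) u v hu hv
        rw [other x k _ hki, other x k _ hki, other x k _ hki]
        refine le_antisymm ?_ ?_
        · exact additiveHull_le_add (fun y hy => (e y hy).le) (hx i)
            (otherb x k u hki hx hu) (otherb x k v hki hx hv)
        · exact add_le_additiveHull (fun y hy => (e y hy).ge) (hx i) (others x k u hki hx hu)
            (others x k v hki hx hv) (otherb x k _ hki hx (add_nonneg hu hv))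
            (otherb x k u hki hx hu) (otherb x k v hki hx hv)
    · refine (hlow x hx).trans ?_
      have := le_additiveHull_self (hbdd x hx (x i)) (hx i)
      rwa [Function.update_eq_self] at this
    · refine csSup_le (partitionSums_nonempty (hx i)) fun r hr => ?_
      have := hbound G hG hG' x hx (x i) r hr
      rwa [Function.update_eq_self] at this

/-- A multisubadditive function with a multiadditive majorant has a least one. -/
theorem exists_least_multiadditive [Fintype ι] {F₀ G₀ : (ι → X) → ℝ}
    (hF₀ : ∀ x : ι → X, (∀ j, 0 ≤ x j) → ∀ i,
      IsSubadditiveOnCone fun y => F₀ (Function.update x i y))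
    (hG₀ : IsMultiadditiveOnCone G₀) (hle : ∀ x : ι → X, (∀ j, 0 ≤ x j) → F₀ x ≤ G₀ x) :
    ∃ F : (ι → X) → ℝ, IsMultiadditiveOnCone F ∧
      (∀ x : ι → X, (∀ j, 0 ≤ x j) → F₀ x ≤ F x) ∧
      ∀ G : (ι → X) → ℝ, IsMultiadditiveOnCone G →
        (∀ x : ι → X, (∀ j, 0 ≤ x j) → F₀ x ≤ G x) → ∀ x : ι → X, (∀ j, 0 ≤ x j) → F x ≤ G x := by
  obtain ⟨F, -, h2, h3, h4⟩ := exists_partial_hull hF₀ hG₀ hle Finset.univ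
  exact ⟨F, fun x hx i => h2 i (Finset.mem_univ i) x hx, h3, h4⟩

end MultiadditiveHull

/-! ### Extension from the positive cone -/

section Extension

variable {X : Type*} [AddCommGroup X] [Lattice X] [IsOrderedAddMonoid X]
  [Module ℝ X] [IsOrderedModule ℝ X]

/-- An additive and positively homogeneous map on the positive cone extends linearly. -/
theorem exists_linear_extension {W : Type*} [AddCommGroup W] [Module ℝ W] {T : X → W}
    (hadd : ∀ u v : X, 0 ≤ u → 0 ≤ v → T (u + v) = T u + T v)
    (hsmul : ∀ (c : ℝ) (u : X), 0 ≤ c → 0 ≤ u → T (c • u) = c • T u) :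
    ∃ ℓ : X →ₗ[ℝ] W, ∀ x, 0 ≤ x → ℓ x = T x := by
  -- The extension may be computed from any decomposition into positive vectors, which gives
  -- linearity.
  have wd : ∀ a b u : X, 0 ≤ a → 0 ≤ b → u = a - b → T u⁺ - T u⁻ = T a - T b := by
    intro a b u ha hb e
    rw [sub_eq_sub_iff_add_eq_add, ← hadd _ _ (posPart_nonneg u) hb,
      ← hadd _ _ ha (negPart_nonneg u)]
    congr 1
    rw [← sub_eq_sub_iff_add_eq_add, posPart_sub_negPart, e]
  have wd' : ∀ u : X, u = u⁺ - u⁻ := fun u => (posPart_sub_negPart u).symm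
  refine ⟨⟨⟨fun u => T u⁺ - T u⁻, fun u v => ?_⟩, fun c u => ?_⟩, fun x hx => ?_⟩
  · rw [wd (u⁺ + v⁺) (u⁻ + v⁻) (u + v) (add_nonneg (posPart_nonneg u) (posPart_nonneg v))
      (add_nonneg (negPart_nonneg u) (negPart_nonneg v)),
      hadd _ _ (posPart_nonneg u) (posPart_nonneg v),
      hadd _ _ (negPart_nonneg u) (negPart_nonneg v)]
    · abel
    · rw [add_sub_add_comm, ← wd' u, ← wd' v]
  · simp only [RingHom.id_apply]
    rcases le_total 0 c with hc | hc
    · rw [wd (c • u⁺) (c • u⁻) (c • u) (smul_nonneg hc (posPart_nonneg u))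
        (smul_nonneg hc (negPart_nonneg u)) (by rw [← smul_sub, ← wd' u]),
        hsmul _ _ hc (posPart_nonneg u), hsmul _ _ hc (negPart_nonneg u), smul_sub]
    · have hc' := neg_nonneg.2 hc
      rw [wd ((-c) • u⁻) ((-c) • u⁺) (c • u) (smul_nonneg hc' (negPart_nonneg u))
        (smul_nonneg hc' (posPart_nonneg u)), hsmul _ _ hc' (posPart_nonneg u),
        hsmul _ _ hc' (negPart_nonneg u)]
      · module
      · rw [← smul_sub, neg_smul, ← smul_neg, neg_sub, ← wd' u]
  · have := wd x 0 x hx le_rfl (by simp)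
    have h0 := hadd 0 0 le_rfl le_rfl
    rw [add_zero, left_eq_add] at h0
    rw [h0, sub_zero] at this
    exact this

/-- A real form is determined by its values on the positive cone. -/
theorem multilinear_eq_zero_of_nonneg {ι : Type*} [Fintype ι] {W : Type*} [AddCommGroup W]
    [Module ℝ W] {B : MultilinearMap ℝ (fun _ : ι => X) W}
    (h : ∀ x : ι → X, (∀ i, 0 ≤ x i) → B x = 0) : B = 0 := by
  classical
  ext x
  have e : x = fun i => ∑ j : Bool,
      (bif j then (1 : ℝ) else -1) • (bif j then (x i)⁺ else (x i)⁻) := by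
    funext i
    simp [← sub_eq_add_neg]
  rw [e, B.map_sum]
  refine Finset.sum_eq_zero fun r _ => ?_
  rw [B.map_smul_univ, h, smul_zero]
  intro i
  cases r i
  exacts [negPart_nonneg _, posPart_nonneg _]

end Extension

/-! ### Existence of the absolute value -/

namespace ComplexBanachLattice

variable {X E : Type*}
  [NormedAddCommGroup X] [Lattice X] [IsOrderedAddMonoid X] [HasSolidNorm X]
  [NormedSpace ℝ X] [IsOrderedModule ℝ X] [CompleteSpace X]
  [NormedAddCommGroup E] [NormedSpace ℂ E]
  (L : ComplexBanachLattice X E) {m : ℕ}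

theorem re_im_add (z w : E) :
    L.re (z + w) = L.re z + L.re w ∧ L.im (z + w) = L.im z + L.im w := by
  apply L.re_im_eq
  nth_rewrite 1 [L.re_add_im z, L.re_add_im w]
  rw [map_add, map_add]
  module

theorem re_im_smul (c : ℂ) (z : E) :
    L.re (c • z) = c.re • L.re z - c.im • L.im z ∧
      L.im (c • z) = c.im • L.re z + c.re • L.im z := by
  apply L.re_im_eq
  nth_rewrite 1 [L.re_add_im z]
  have hc : c = (c.re : ℂ) + (c.im : ℂ) * Complex.I := (Complex.re_add_im c).symm
  nth_rewrite 1 [hc]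
  rw [map_sub, map_add, map_smul, map_smul, map_smul, map_smul, ← Complex.coe_smul,
    ← Complex.coe_smul, ← Complex.coe_smul, ← Complex.coe_smul]
  have hI : Complex.I * Complex.I = -1 := Complex.I_mul_I
  match_scalars
  · ring
  · linear_combination (c.im : ℂ) * hI

/-- The target is general because it is applied both to scalars and to spaces of forms in the
remaining variables. -/
theorem exists_complexification {W : Type*} [AddCommGroup W] [Module ℂ W] [Module ℝ W]
    [IsScalarTower ℝ ℂ W] (ℓ : X →ₗ[ℝ] W) :
    ∃ Λ : E →ₗ[ℂ] W, ∀ x, Λ (L.ofReal x) = ℓ x := by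
  refine ⟨⟨⟨fun z => ℓ (L.re z) + Complex.I • ℓ (L.im z), fun z w => ?_⟩, fun c z => ?_⟩,
    fun x => ?_⟩
  · rw [(L.re_im_add z w).1, (L.re_im_add z w).2, map_add, map_add]
    module
  · simp only [RingHom.id_apply]
    have hs : ∀ (t : ℝ) (w : W), t • w = (t : ℂ) • w := fun t w => by
      rw [← Complex.coe_algebraMap, algebraMap_smul]
    rw [(L.re_im_smul c z).1, (L.re_im_smul c z).2, map_sub, map_add, map_smul, map_smul, map_smul,
      map_smul, hs, hs, hs, hs]
    have hc : c = (c.re : ℂ) + (c.im : ℂ) * Complex.I := (Complex.re_add_im c).symm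
    have hI : Complex.I * Complex.I = -1 := Complex.I_mul_I
    match_scalars
    · linear_combination -hc
    · linear_combination -Complex.I * hc - (c.im : ℂ) * hI
  · simp [L.re_im_ofReal x]

/-- A multiadditive and positively homogeneous function on the positive cone extends to a form. -/
theorem exists_form_of_multiadditive : ∀ {m : ℕ} {F : (Fin m → X) → ℝ},
    IsMultiadditiveOnCone F →
    (∀ x : Fin m → X, (∀ j, 0 ≤ x j) → ∀ (i : Fin m) (c : ℝ) (u : X), 0 ≤ c → 0 ≤ u →
      F (Function.update x i (c • u)) = c * F (Function.update x i u)) →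
    ∃ A : MultilinearMap ℂ (fun _ : Fin m => E) ℂ,
      ∀ x : Fin m → X, (∀ j, 0 ≤ x j) → (A fun i => L.ofReal (x i)) = F x
  | 0, F, _, _ => by
    refine ⟨MultilinearMap.constOfIsEmpty ℂ _ (F Fin.elim0 : ℂ), fun x _ => ?_⟩
    simp [Subsingleton.elim x Fin.elim0]
  | m + 1, F, hadd, hsmul => by
    have consn : ∀ {u : X} {x : Fin m → X}, 0 ≤ u → (∀ j, 0 ≤ x j) →
        ∀ j, (0 : X) ≤ (Fin.cons u x : Fin (m + 1) → X) j := by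
      intro u x hu hx j
      refine Fin.cases ?_ (fun j => ?_) j
      · simpa using hu
      · simpa using hx j
    -- Freezing a first variable `u ≥ 0` gives a form in the others by induction; off the cone the
    -- slice is filled with `0`. As forms are determined on positive vectors, the slices depend
    -- additively on `u`, and this dependence extends linearly.
    have slice : ∀ u : X, ∃ A : MultilinearMap ℂ (fun _ : Fin m => E) ℂ, 0 ≤ u →
        ∀ x : Fin m → X, (∀ j, 0 ≤ x j) →
          (A fun i => L.ofReal (x i)) = F (Fin.cons u x) := by
      intro u
      by_cases hu : 0 ≤ u
      · obtain ⟨A, hA⟩ := exists_form_of_multiadditive (F := fun x => F (Fin.cons u x))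
          (fun x hx i a b ha hb => by
            simp only [Fin.cons_update]
            exact hadd _ (consn hu hx) i.succ a b ha hb)
          (fun x hx i c a hc ha => by
            simp only [Fin.cons_update]
            exact hsmul _ (consn hu hx) i.succ c a hc ha)
        exact ⟨A, fun _ => hA⟩
      · exact ⟨0, fun h => absurd h hu⟩
    choose T hT using slice
    have hup : ∀ (u : X) (x : Fin m → X),
        (Fin.cons u x : Fin (m + 1) → X) = Function.update (Fin.cons 0 x) 0 u := by
      intro u x
      rw [Fin.update_cons_zero]
    obtain ⟨ℓ, hℓ⟩ := exists_linear_extension (T := T)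
      (fun u v hu hv => L.ext_of_nonneg fun x hx => by
        rw [add_apply, hT _ hu x hx, hT _ hv x hx, hT _ (add_nonneg hu hv) x hx,
          hup, hadd _ (consn le_rfl hx) 0 u v hu hv, ← hup, ← hup, Complex.ofReal_add])
      (fun c u hc hu => L.ext_of_nonneg fun x hx => by
        rw [smul_apply, hT _ hu x hx, hT _ (smul_nonneg hc hu) x hx,
          hup, hsmul _ (consn le_rfl hx) 0 c u hc hu, ← hup, Complex.ofReal_mul, Complex.real_smul])
    obtain ⟨Λ, hΛ⟩ := L.exists_complexification ℓ
    refine ⟨Λ.uncurryLeft, fun x hx => ?_⟩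
    have e : (fun i => L.ofReal (x i)) =
        (Fin.cons (L.ofReal (x 0)) fun i : Fin m => L.ofReal (x i.succ) : Fin (m + 1) → E) := by
      funext j
      refine Fin.cases ?_ (fun j => ?_) j <;> simp
    rw [e, LinearMap.uncurryLeft_apply, Fin.cons_zero, Fin.tail_cons, hΛ, hℓ _ (hx 0),
      hT _ (hx 0) _ fun j => hx _]
    congr 2
    exact Fin.cons_self_tail x

theorem norm_le_iff_forall_cos_sin {w : ℂ} {C : ℝ} :
    ‖w‖ ≤ C ↔ ∀ θ : ℝ, Real.cos θ * w.re + Real.sin θ * w.im ≤ C := by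
  constructor
  · intro h θ
    have e : Real.cos θ * w.re + Real.sin θ * w.im =
        (Complex.exp (((-θ : ℝ) : ℂ) * Complex.I) * w).re := by
      rw [Complex.mul_re, Complex.exp_ofReal_mul_I_re, Complex.exp_ofReal_mul_I_im, Real.cos_neg,
        Real.sin_neg]
      ring
    rw [e]
    refine (Complex.re_le_norm _).trans ?_
    rwa [norm_mul, Complex.norm_exp_ofReal_mul_I, one_mul]
  · intro h
    have := h w.arg
    refine le_trans (le_of_eq ?_) this
    have h1 := Complex.norm_mul_cos_arg w
    have h2 := Complex.norm_mul_sin_arg w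
    have h3 := Real.sin_sq_add_cos_sq w.arg
    rw [← h1, ← h2]
    linear_combination -‖w‖ * h3

/-- This turns the supremum over `θ` in the order of forms into pointwise domination on the cone. -/
theorem forall_formLE_iff {A : MultilinearMap ℂ (fun _ : Fin m => E) ℂ}
    {B : MultilinearMap ℝ (fun _ : Fin m => X) ℝ} :
    (∀ θ : ℝ, FormLE (Real.cos θ • L.reForm A + Real.sin θ • L.imForm A) B) ↔
      ∀ x : Fin m → X, (∀ i, 0 ≤ x i) → ‖A fun i => L.ofReal (x i)‖ ≤ B x := by
  constructor
  · intro h x hx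
    exact norm_le_iff_forall_cos_sin.2 fun θ => h θ x hx
  · intro h θ x hx
    exact norm_le_iff_forall_cos_sin.1 (h x hx) θ

theorem reForm_apply (A : MultilinearMap ℂ (fun _ : Fin m => E) ℂ) (x : Fin m → X) :
    L.reForm A x = (A fun i => L.ofReal (x i)).re := rfl

theorem imForm_apply (A : MultilinearMap ℂ (fun _ : Fin m => E) ℂ) (x : Fin m → X) :
    L.imForm A x = (A fun i => L.ofReal (x i)).im := rfl

theorem isSymmForm_of_nonneg {M : MultilinearMap ℂ (fun _ : Fin m => E) ℂ}
    (h : ∀ (σ : Equiv.Perm (Fin m)) (x : Fin m → X), (∀ i, 0 ≤ x i) →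
      (M fun i => L.ofReal (x (σ i))) = M fun i => L.ofReal (x i)) : IsSymmForm M := by
  intro σ z
  have := L.ext_of_nonneg (A := M.domDomCongr σ) (A' := M) (fun x hx => h σ x hx)
  exact congrArg (fun A : MultilinearMap ℂ (fun _ : Fin m => E) ℂ => A z) this

theorem imForm_eq_zero {M : MultilinearMap ℂ (fun _ : Fin m => E) ℂ}
    (h : ∀ x : Fin m → X, (∀ i, 0 ≤ x i) → (M fun i => L.ofReal (x i)).im = 0) :
    L.imForm M = 0 :=
  multilinear_eq_zero_of_nonneg fun x hx => h x hx

/-- A symmetric form dominated on the positive cone has an absolute value. -/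
theorem exists_isAbsForm {A : MultilinearMap ℂ (fun _ : Fin m => E) ℂ} (hA : IsSymmForm A)
    {B : MultilinearMap ℝ (fun _ : Fin m => X) ℝ}
    (h : ∀ x : Fin m → X, (∀ i, 0 ≤ x i) → ‖A fun i => L.ofReal (x i)‖ ≤ B x) :
    ∃ M, L.IsAbsForm A M := by
  have upd : ∀ (x : Fin m → X) (i : Fin m) (y : X),
      (fun j => L.ofReal (Function.update x i y j)) =
        Function.update (fun j => L.ofReal (x j)) i (L.ofReal y) := by
    intro x i y
    exact (Function.comp_update L.ofReal x i y)
  obtain ⟨F, hadd, hlow, hleast⟩ := exists_least_multiadditive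
    (F₀ := fun x => ‖A fun i => L.ofReal (x i)‖) (G₀ := B)
    (fun x hx i => ⟨by
        simp only [upd, map_zero, MultilinearMap.map_update_zero, norm_zero, le_refl],
      fun u v _ _ => by
        simp only [upd, map_add, MultilinearMap.map_update_add]
        exact norm_add_le _ _⟩)
    (fun x _ i u v _ _ => B.map_update_add x i u v) h
  -- Homogeneity comes from leastness: scaling one variable by `c` and the value by `c⁻¹` gives
  -- another multiadditive majorant. Using `c⁻¹` then reverses the inequality.
  have hpos : ∀ (c : ℝ), 0 < c → ∀ x : Fin m → X, (∀ j, 0 ≤ x j) → ∀ i u, 0 ≤ u →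
      c * F (Function.update x i u) ≤ F (Function.update x i (c • u)) := by
    intro c hc x hx i u hu
    have := hleast (fun y => c⁻¹ * F (Function.update y i (c • y i))) ?_ ?_ _
      (update_nonneg_of_nonneg hx (i := i) hu)
    · simp only [Function.update_idem, Function.update_self] at this
      rwa [le_inv_mul_iff₀ hc] at this
    · intro y hy k a b ha hb
      rcases eq_or_ne k i with rfl | hk
      · simp only [Function.update_idem, Function.update_self, smul_add]
        rw [hadd y hy k _ _ (smul_nonneg hc.le ha) (smul_nonneg hc.le hb)]
        ring
      · simp only [Function.update_of_ne hk.symm, Function.update_comm hk]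
        rw [hadd _ (update_nonneg_of_nonneg hy (smul_nonneg hc.le (hy i))) k a b ha hb]
        ring
    · intro y hy
      have := hlow _ (update_nonneg_of_nonneg hy (i := i) (smul_nonneg hc.le (hy i)))
      rw [le_inv_mul_iff₀ hc]
      refine le_trans (le_of_eq ?_) this
      simp only [upd, map_smul]
      rw [← Complex.coe_smul, MultilinearMap.map_update_smul, norm_smul, Complex.norm_real,
        Real.norm_of_nonneg hc.le]
      congr 3
      exact (Function.update_eq_self i (fun j => L.ofReal (y j))).symm
  have hsmul : ∀ x : Fin m → X, (∀ j, 0 ≤ x j) → ∀ (i : Fin m) (c : ℝ) (u : X), 0 ≤ c → 0 ≤ u →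
      F (Function.update x i (c • u)) = c * F (Function.update x i u) := by
    intro x hx i c u hc hu
    rcases hc.eq_or_lt with rfl | hc
    · have := hadd x hx i 0 0 le_rfl le_rfl
      rw [add_zero] at this
      simp only [zero_smul, zero_mul]
      linarith
    · refine le_antisymm ?_ (hpos c hc x hx i u hu)
      have := hpos c⁻¹ (inv_pos.2 hc) x hx i (c • u) (smul_nonneg hc.le hu)
      rwa [smul_smul, inv_mul_cancel₀ hc.ne', one_smul, inv_mul_le_iff₀ hc] at this
  -- By symmetry of `A`, permuting the variables of `F` also gives a majorant.
  have hsymm : ∀ (σ : Equiv.Perm (Fin m)) (x : Fin m → X), (∀ j, 0 ≤ x j) →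
      F x ≤ F fun i => x (σ i) := by
    intro σ x hx
    refine hleast (fun x => F fun i => x (σ i)) ?_ ?_ x hx
    · intro y hy i a b ha hb
      have e : ∀ c, (fun j => Function.update y i c (σ j)) =
          Function.update (fun j => y (σ j)) (σ.symm i) c :=
        fun c => Function.update_comp_equiv y σ i c
      simp only [e]
      exact hadd _ (fun j => hy _) _ a b ha hb
    · intro y hy
      refine le_trans (le_of_eq ?_) (hlow _ fun j => hy _)
      rw [hA σ fun i => L.ofReal (y i)]
  obtain ⟨M, hM⟩ := L.exists_form_of_multiadditive hadd hsmul
  refine ⟨M, L.isSymmForm_of_nonneg fun σ x hx => ?_, L.imForm_eq_zero fun x hx => ?_, ?_, ?_⟩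
  · rw [hM _ fun j => hx _, hM x hx]
    congr 1
    refine le_antisymm ?_ (hsymm σ x hx)
    have := hsymm σ.symm (fun i => x (σ i)) fun j => hx _
    simpa using this
  · rw [hM x hx, Complex.ofReal_im]
  · rw [forall_formLE_iff]
    intro x hx
    rw [reForm_apply, hM x hx, Complex.ofReal_re]
    exact hlow x hx
  · intro G _ hG x hx
    rw [forall_formLE_iff] at hG
    rw [reForm_apply, hM x hx, Complex.ofReal_re]
    exact hleast G (fun x _ i u v _ _ => G.map_update_add x i u v) hG x hx

end ComplexBanachLattice

/-! ### Monotonicity and polarization of positive forms -/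

section PositiveForm

variable {X : Type*} [AddCommGroup X] [Lattice X] [IsOrderedAddMonoid X] [Module ℝ X] {m : ℕ}

/-- In the expansion of `B (x + (y - x))` all terms are nonnegative and one of them is `B x`. -/
theorem FormLE.apply_mono {B : MultilinearMap ℝ (fun _ : Fin m => X) ℝ} (hB : FormLE 0 B)
    {x y : Fin m → X} (hx : ∀ i, 0 ≤ x i) (hxy : ∀ i, x i ≤ y i) : B x ≤ B y := by
  have e : y = x + (y - x) := by abel
  rw [e, B.map_add_univ]
  refine le_trans (le_of_eq ?_) (Finset.single_le_sum
    (f := fun s : Finset (Fin m) => B (s.piecewise x (y - x))) (fun s _ => ?_)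
    (Finset.mem_univ Finset.univ))
  · simp
  · refine hB _ fun i => ?_
    by_cases hi : i ∈ s
    · simpa [hi] using hx i
    · simpa [hi] using hxy i

/-- The polarization inequality for positive symmetric forms. -/
theorem factorial_mul_apply_le {B : MultilinearMap ℝ (fun _ : Fin m => X) ℝ} (hB : FormLE 0 B)
    (hs : IsSymmForm B) {x : Fin m → X} (hx : ∀ i, 0 ≤ x i) :
    (m ! : ℝ) * B x ≤ B fun _ => ∑ i, x i := by
  rw [B.map_sum]
  have e : (m ! : ℝ) * B x = ∑ σ : Equiv.Perm (Fin m), B fun i => x (σ i) := by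
    simp only [hs _ x, Finset.sum_const, Finset.card_univ, Fintype.card_perm, Fintype.card_fin,
      nsmul_eq_mul]
  rw [e]
  -- The expansion runs over all maps of the indices; the permutations give `m!` equal terms and the
  -- rest are nonnegative.
  have inj : Function.Injective fun σ : Equiv.Perm (Fin m) => (σ : Fin m → Fin m) :=
    DFunLike.coe_injective
  rw [← Finset.sum_image (s := Finset.univ) (g := fun σ : Equiv.Perm (Fin m) => (σ : Fin m → Fin m))
    (f := fun r : Fin m → Fin m => B fun i => x (r i)) (fun _ _ _ _ h => inj h)]
  exact Finset.sum_le_sum_of_subset_of_nonneg (Finset.subset_univ _)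
    fun r _ _ => hB _ fun i => hx _

end PositiveForm

/-! ### The supremum norm -/

section SupNorm

variable {E : Type*} [NormedAddCommGroup E] [NormedSpace ℂ E] {m : ℕ}

theorem enorm_apply_le_supNorm (A : MultilinearMap ℂ (fun _ : Fin m => E) ℂ) {z : E}
    (hz : ‖z‖ ≤ 1) : ‖A fun _ => z‖ₑ ≤ supNorm A :=
  le_iSup₂ (f := fun (z : E) (_ : ‖z‖ ≤ 1) => ‖A fun _ => z‖ₑ) z hz

theorem norm_apply_le_of_supNorm_le {A : MultilinearMap ℂ (fun _ : Fin m => E) ℂ} {C : ℝ}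
    (hC : 0 ≤ C) (h : supNorm A ≤ ENNReal.ofReal C) (z : E) :
    ‖A fun _ => z‖ ≤ C * ‖z‖ ^ m := by
  have unit : ∀ z : E, ‖z‖ ≤ 1 → ‖A fun _ => z‖ ≤ C := by
    intro z hz
    have := (enorm_apply_le_supNorm A hz).trans h
    rwa [← ofReal_norm, ENNReal.ofReal_le_ofReal_iff hC] at this
  rcases eq_or_ne z 0 with rfl | hz
  · rcases m.eq_zero_or_pos with rfl | hm
    · simpa using unit 0 (by simp)
    · rw [A.map_coord_zero ⟨0, hm⟩ rfl, norm_zero]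
      positivity
  · have hz' : (‖z‖ : ℂ) ≠ 0 := by simpa using hz
    have e : (fun _ : Fin m => z) = fun i => ((‖z‖ : ℂ)) • ((‖z‖ : ℂ)⁻¹ • z) := by
      funext i
      rw [smul_smul, mul_inv_cancel₀ hz', one_smul]
    rw [e, A.map_smul_univ (fun _ => (‖z‖ : ℂ)), norm_smul, mul_comm]
    simp only [Finset.prod_const, Finset.card_univ, Fintype.card_fin, norm_pow, Complex.norm_real,
      norm_norm]
    gcongr
    refine unit _ ?_
    rw [norm_smul, norm_inv, Complex.norm_real, norm_norm, inv_mul_cancel₀ (norm_ne_zero_iff.2 hz)]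

theorem supNorm_smul (c : ℂ) (A : MultilinearMap ℂ (fun _ : Fin m => E) ℂ) :
    supNorm (c • A) = ‖c‖ₑ * supNorm A := by
  simp only [supNorm, smul_apply, enorm_smul, ENNReal.mul_iSup]

end SupNorm

/-! ### Properties of the absolute value and the two inequalities -/

namespace ComplexBanachLattice

variable {X E : Type*}
  [NormedAddCommGroup X] [Lattice X] [IsOrderedAddMonoid X] [HasSolidNorm X]
  [NormedSpace ℝ X] [IsOrderedModule ℝ X] [CompleteSpace X]
  [NormedAddCommGroup E] [NormedSpace ℂ E]
  {L : ComplexBanachLattice X E} {m : ℕ}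

variable {A M M' : MultilinearMap ℂ (fun _ : Fin m => E) ℂ}

theorem IsAbsForm.norm_apply_ofReal_le (h : L.IsAbsForm A M) (x : Fin m → X)
    (hx : ∀ i, 0 ≤ x i) : ‖A fun i => L.ofReal (x i)‖ ≤ L.reForm M x :=
  L.forall_formLE_iff.1 h.2.2.1 x hx

theorem IsAbsForm.apply_ofReal (h : L.IsAbsForm A M) (x : Fin m → X) :
    (M fun i => L.ofReal (x i)) = L.reForm M x := by
  have := congrArg (fun B : MultilinearMap ℝ (fun _ : Fin m => X) ℝ => B x) h.2.1
  apply Complex.ext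
  · simp [reForm_apply]
  · simpa [imForm_apply] using this

theorem IsAbsForm.reForm_nonneg (h : L.IsAbsForm A M) : FormLE 0 (L.reForm M) := fun x hx =>
  (norm_nonneg _).trans (h.norm_apply_ofReal_le x hx)

theorem IsAbsForm.isSymmForm_reForm (h : L.IsAbsForm A M) : IsSymmForm (L.reForm M) := by
  intro σ x
  rw [reForm_apply, reForm_apply, h.1 σ fun i => L.ofReal (x i)]

theorem IsAbsForm.norm_apply_le (h : L.IsAbsForm A M) (z : Fin m → E) :
    ‖A z‖ ≤ L.reForm M fun i => L.abs (z i) :=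
  L.norm_apply_le_of_le_on_nonneg h.norm_apply_ofReal_le z

theorem isAbsForm_self (hM : IsSymmForm M) (him : L.imForm M = 0) (h0 : FormLE 0 (L.reForm M)) :
    L.IsAbsForm M M := by
  have e : ∀ x, (∀ i, 0 ≤ x i) → ‖M fun i => L.ofReal (x i)‖ = L.reForm M x := by
    intro x hx
    have h1 : (M fun i => L.ofReal (x i)) = L.reForm M x := by
      have := congrArg (fun B : MultilinearMap ℝ (fun _ : Fin m => X) ℝ => B x) him
      apply Complex.ext
      · simp [reForm_apply]
      · simpa [imForm_apply] using this
    rw [h1, Complex.norm_real, Real.norm_of_nonneg (h0 x hx)]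
  refine ⟨hM, him, L.forall_formLE_iff.2 fun x hx => (e x hx).le, fun B _ hB x hx => ?_⟩
  rw [← e x hx]
  exact L.forall_formLE_iff.1 hB x hx

theorem IsAbsForm.self (h : L.IsAbsForm A M) : L.IsAbsForm M M :=
  isAbsForm_self h.1 h.2.1 h.reForm_nonneg

theorem IsAbsForm.unique (h : L.IsAbsForm A M) (h' : L.IsAbsForm A M') : M = M' := by
  refine L.ext_of_nonneg fun x hx => ?_
  rw [h.apply_ofReal, h'.apply_ofReal]
  congr 1
  exact le_antisymm (h.2.2.2 _ h'.isSymmForm_reForm h'.2.2.1 x hx)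
    (h'.2.2.2 _ h.isSymmForm_reForm h.2.2.1 x hx)

theorem IsAbsForm.regNorm_eq (h : L.IsAbsForm A M) : L.regNorm A = supNorm M := by
  refine le_antisymm (iInf₂_le M h) (le_iInf₂ fun M' h' => ?_)
  rw [h.unique h']

theorem IsAbsForm.smul (h : L.IsAbsForm A M) {c : ℝ} (hc : 0 < c) :
    L.IsAbsForm ((c : ℂ) • A) ((c : ℂ) • M) := by
  have hre : L.reForm ((c : ℂ) • M) = c • L.reForm M := by
    ext x
    simp [reForm_apply]
  refine ⟨fun σ x => by simp only [smul_apply, h.1 σ x], ?_, ?_, fun B hB hle x hx => ?_⟩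
  · ext x
    have := congrArg (fun B : MultilinearMap ℝ (fun _ : Fin m => X) ℝ => B x) h.2.1
    simp only [imForm_apply] at this
    simp [imForm_apply, this]
  · rw [forall_formLE_iff]
    intro x hx
    rw [hre, smul_apply, smul_apply, norm_smul, Complex.norm_real, Real.norm_of_nonneg hc.le,
      smul_eq_mul]
    gcongr
    exact h.norm_apply_ofReal_le x hx
  · rw [forall_formLE_iff] at hle
    have := h.2.2.2 (c⁻¹ • B) (fun σ x => by simp only [smul_apply, hB σ x]) ?_ x hx
    · rw [hre, smul_apply, smul_eq_mul]
      rwa [smul_apply, smul_eq_mul, le_inv_mul_iff₀ hc] at this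
    · rw [forall_formLE_iff]
      intro x hx
      have := hle x hx
      rw [smul_apply, norm_smul, Complex.norm_real, Real.norm_of_nonneg hc.le] at this
      rwa [smul_apply, smul_eq_mul, le_inv_mul_iff₀ hc]

/-- Domination gives `|P z| ≤ |P| |z|`, and `|z|` has the norm of `z`. -/
theorem supNorm_le_regNorm (L : ComplexBanachLattice X E)
    (A : MultilinearMap ℂ (fun _ : Fin m => E) ℂ) : supNorm A ≤ L.regNorm A := by
  refine le_iInf₂ fun M h => iSup₂_le fun z hz => ?_
  have h1 : ‖A fun _ => z‖ₑ ≤ ‖M fun _ => L.ofReal (L.abs z)‖ₑ := by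
    have h2 := h.norm_apply_le fun _ => z
    rw [enorm_le_iff_norm_le, h.apply_ofReal fun _ => L.abs z, Complex.norm_real]
    exact h2.trans (Real.le_norm_self _)
  refine h1.trans (enorm_apply_le_supNorm M ?_)
  rwa [L.norm_ofReal, ← L.norm_eq]

theorem isRegular_of_norm_le (L : ComplexBanachLattice X E) (hA : IsSymmForm A)
    {B : MultilinearMap ℝ (fun _ : Fin m => X) ℝ}
    (hB : IsSymmForm B)
    (h : ∀ x : Fin m → X, (∀ i, 0 ≤ x i) → ‖A fun i => L.ofReal (x i)‖ ≤ B x) :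
    L.IsRegular A := by
  have h0 : FormLE 0 B := fun x hx => (norm_nonneg _).trans (h x hx)
  refine ⟨hA, ⟨B, B - L.reForm A, hB, fun σ x => ?_, h0, fun x hx => ?_, by abel⟩,
    ⟨B, B - L.imForm A, hB, fun σ x => ?_, h0, fun x hx => ?_, by abel⟩⟩
  · rw [sub_apply, sub_apply, hB σ x, reForm_apply, reForm_apply, hA σ fun i => L.ofReal (x i)]
  · exact sub_nonneg.2 ((Complex.re_le_norm _).trans (h x hx))
  · rw [sub_apply, sub_apply, hB σ x, imForm_apply, imForm_apply, hA σ fun i => L.ofReal (x i)]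
  · exact sub_nonneg.2 ((Complex.im_le_norm _).trans (h x hx))

theorem IsRegular.exists_isAbsForm (h : L.IsRegular A) : ∃ M, L.IsAbsForm A M := by
  obtain ⟨hA, ⟨B, C, -, -, hB, hC, e⟩, ⟨B', C', -, -, hB', hC', e'⟩⟩ := h
  refine L.exists_isAbsForm hA (B := B + C + (B' + C')) fun x hx => ?_
  refine (Complex.norm_le_abs_re_add_abs_im _).trans ?_
  rw [← reForm_apply, ← imForm_apply, e, e']
  simp only [add_apply, sub_apply]
  have h1 := hB x hx
  have h2 := hC x hx
  have h3 := hB' x hx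
  have h4 := hC' x hx
  simp only [zero_apply] at h1 h2 h3 h4
  exact add_le_add (abs_le.2 ⟨by linarith, by linarith⟩) (abs_le.2 ⟨by linarith, by linarith⟩)

theorem IsAbsForm.isRegular (h : L.IsAbsForm A M) (hA : IsSymmForm A) : L.IsRegular A :=
  L.isRegular_of_norm_le hA h.isSymmForm_reForm h.norm_apply_ofReal_le

/-- Positive forms on a Banach lattice are bounded. -/
theorem IsAbsForm.supNorm_lt_top (h : L.IsAbsForm A M) : supNorm M < ⊤ := by
  by_contra hne
  rw [not_lt, top_le_iff] at hne
  have hM := h.self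
  have hpos := h.reForm_nonneg
  -- The factor `2^{nm}` pays for the weights `2^{-n}` in the sum `y`, which dominates every
  -- weighted `x n`; monotonicity then makes the value at `y` exceed every `n`.
  have ex : ∀ n : ℕ, ∃ x : X, 0 ≤ x ∧ ‖x‖ ≤ 1 ∧ ((2 : ℝ) ^ n) ^ m * n ≤ L.reForm M fun _ => x := by
    intro n
    have : ENNReal.ofReal (((2 : ℝ) ^ n) ^ m * n) < supNorm M := by
      rw [hne]; exact ENNReal.ofReal_lt_top
    rw [supNorm] at this
    obtain ⟨z, hz⟩ := lt_iSup_iff.1 this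
    obtain ⟨hz1, hz2⟩ := lt_iSup_iff.1 hz
    refine ⟨L.abs z, L.abs_nonneg z, by rwa [← L.norm_eq], ?_⟩
    rw [← ofReal_norm, ENNReal.ofReal_lt_ofReal_iff_of_nonneg (by positivity)] at hz2
    exact hz2.le.trans (hM.norm_apply_le fun _ => z)
  choose x hx0 hx1 hx2 using ex
  have hsum : Summable fun n => ((2 : ℝ) ^ n)⁻¹ • x n := by
    refine Summable.of_norm_bounded (g := fun n : ℕ => (1 / 2 : ℝ) ^ n) summable_geometric_two
      fun n => ?_
    rw [norm_smul, norm_inv, norm_pow, Real.norm_of_nonneg zero_le_two, one_div, inv_pow]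
    exact mul_le_of_le_one_right (by positivity) (hx1 n)
  set y := ∑' n, ((2 : ℝ) ^ n)⁻¹ • x n with hy
  have hle : ∀ n, ((2 : ℝ) ^ n)⁻¹ • x n ≤ y := fun n =>
    hsum.le_tsum n fun k _ => smul_nonneg (by positivity) (hx0 k)
  have hB : ∀ n : ℕ, (n : ℝ) ≤ L.reForm M fun _ => y := by
    intro n
    have h1 := hpos.apply_mono (x := fun _ => ((2 : ℝ) ^ n)⁻¹ • x n) (y := fun _ => y)
      (fun _ => smul_nonneg (by positivity) (hx0 n)) fun _ => hle n
    rw [(L.reForm M).map_smul_univ (fun _ => ((2 : ℝ) ^ n)⁻¹) fun _ => x n] at h1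
    refine le_trans ?_ h1
    simp only [Finset.prod_const, Finset.card_univ, Fintype.card_fin, smul_eq_mul, inv_pow]
    rw [le_inv_mul_iff₀ (by positivity)]
    exact hx2 n
  obtain ⟨n, hn⟩ := exists_nat_gt (L.reForm M fun _ => y)
  exact absurd (hB n) (not_le.2 hn)

/-- The bound of the norm of a form by the supremum norm of its absolute value. -/
theorem IsAbsForm.reForm_apply_le (h : L.IsAbsForm A M) (h1 : supNorm M ≤ 1) {x : Fin m → X}
    (hx : ∀ i, 0 ≤ x i) : L.reForm M x ≤ Real.exp 1 ^ m * ∏ i, ‖x i‖ := by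
  have hdiag : ∀ s : X, (L.reForm M fun _ => s) ≤ ‖s‖ ^ m := by
    intro s
    have := norm_apply_le_of_supNorm_le zero_le_one (by simpa using h1) (L.ofReal s)
    rw [L.norm_ofReal, one_mul] at this
    exact (Complex.re_le_norm _).trans this
  by_cases hz : ∃ i, x i = 0
  · obtain ⟨i, hi⟩ := hz
    rw [(L.reForm M).map_coord_zero i hi]
    positivity
  push Not at hz
  set y : Fin m → X := fun i => ‖x i‖⁻¹ • x i
  have e : x = fun i => ‖x i‖ • y i := by
    funext i
    rw [smul_smul, mul_inv_cancel₀ (norm_ne_zero_iff.2 (hz i)), one_smul]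
  have hy : ∀ i, 0 ≤ y i := fun i => smul_nonneg (by positivity) (hx i)
  have hy1 : ∀ i, ‖y i‖ = 1 := fun i => by
    rw [norm_smul, norm_inv, norm_norm, inv_mul_cancel₀ (norm_ne_zero_iff.2 (hz i))]
  have hpol := factorial_mul_apply_le h.reForm_nonneg h.isSymmForm_reForm hy
  have hs : ‖∑ i, y i‖ ≤ m := by
    refine (norm_sum_le _ _).trans ?_
    simp [hy1]
  -- The sum of `m` unit vectors has norm at most `m`, and `m^m / m! ≤ e^m`.
  have hb : L.reForm M y ≤ Real.exp 1 ^ m := by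
    have h2 : (m ! : ℝ) * L.reForm M y ≤ (m : ℝ) ^ m :=
      hpol.trans ((hdiag _).trans (by gcongr))
    have h3 := Real.pow_div_factorial_le_exp (x := (m : ℝ)) (by positivity) m
    rw [Real.exp_one_pow]
    refine le_trans ?_ h3
    rw [le_div_iff₀ (by positivity)]
    linarith
  nth_rewrite 1 [e]
  rw [(L.reForm M).map_smul_univ (fun i => ‖x i‖) y, smul_eq_mul, mul_comm]
  gcongr

theorem IsAbsForm.norm_apply_le_exp (h : L.IsAbsForm A M) (h1 : supNorm M ≤ 1) (z : Fin m → E) :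
    ‖A z‖ ≤ Real.exp 1 ^ m * ∏ i, ‖z i‖ := by
  refine (h.norm_apply_le z).trans ((h.reForm_apply_le h1 fun i => L.abs_nonneg _).trans ?_)
  simp only [L.norm_eq, le_refl]

theorem bohrRadius_mul_le (h : L.IsRegular A) (hm : m ≠ 0) :
    L.bohrRadius m * L.regNorm A ^ (1 / (m : ℝ)) ≤ supNorm A ^ (1 / (m : ℝ)) := by
  rw [bohrRadius, ENNReal.iSup_mul]
  refine iSup_le fun ρ => ?_
  rw [ENNReal.iSup_mul]
  refine iSup_le fun hρ => ?_
  have := ENNReal.rpow_le_rpow (hρ A h) (z := 1 / (m : ℝ)) (by positivity)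
  rw [ENNReal.mul_rpow_of_nonneg _ _ (by positivity)] at this
  rwa [one_div, ENNReal.pow_rpow_inv_natCast hm, ← one_div] at this

/-- Below the liminf `K` is large eventually, below the limsup `a` is large frequently, hence both
together frequently. -/
theorem liminf_mul_limsup_le {K a b : ℕ → ℝ≥0∞} (h : ∀ᶠ m in atTop, K m * a m ≤ b m) :
    liminf K atTop * limsup a atTop ≤ limsup b atTop := by
  refine ENNReal.mul_le_of_forall_lt fun c hc d hd => ?_
  refine le_limsup_of_frequently_le ?_
  refine ((frequently_lt_of_lt_limsup (by isBoundedDefault) hd).and_eventually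
    (h.and (eventually_lt_of_lt_liminf hc))).mono fun m hm => ?_
  exact (mul_le_mul' hm.2.2.le hm.1.le).trans hm.2.1

theorem mul_inv_le_inv_of_mul_le {k R S : ℝ≥0∞} (h : k * R ≤ S) : k * S⁻¹ ≤ R⁻¹ := by
  rcases eq_or_ne R 0 with rfl | hR
  · simp
  rcases eq_or_ne S ⊤ with rfl | hS
  · simp
  rcases eq_or_ne k 0 with rfl | hk
  · simp
  have hR' : R ≠ ⊤ := by
    rintro rfl
    rw [ENNReal.mul_top hk, top_le_iff] at h
    exact hS h
  have hS0 : S ≠ 0 := by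
    rintro rfl
    simp [hR, hk] at h
  rw [← div_eq_mul_inv, ENNReal.div_le_iff hS0 hS, mul_comm, ← div_eq_mul_inv,
    ENNReal.le_div_iff_mul_le (Or.inl hR) (Or.inl hR')]
  exact h

theorem liminf_bohrRadius_mul_convRadius_le (f : E → ℂ) (a : E)
    (h : ∀ m, L.IsRegular (taylorForm f a m)) :
    liminf (fun m => L.bohrRadius m) atTop * convRadius f a ≤ L.regConvRadius f a :=
  mul_inv_le_inv_of_mul_le <| liminf_mul_limsup_le <|
    (eventually_ne_atTop 0).mono fun m hm => bohrRadius_mul_le (h m) hm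

theorem regConvRadius_le_convRadius (L : ComplexBanachLattice X E) (f : E → ℂ) (a : E) :
    L.regConvRadius f a ≤ convRadius f a :=
  ENNReal.inv_le_inv.2 <| limsup_le_limsup <| Eventually.of_forall fun _ =>
    ENNReal.rpow_le_rpow (L.supNorm_le_regNorm _) (by positivity)

end ComplexBanachLattice

/-! ### Taylor forms of power series -/

section TaylorForm

variable {E : Type*} [NormedAddCommGroup E] [NormedSpace ℂ E] {f : E → ℂ} {a : E}
  {p : FormalMultilinearSeries ℂ E ℂ} {r : ℝ≥0∞}

theorem taylorForm_apply (hf : HasFPowerSeriesOnBall f p a r) {m : ℕ} (v : Fin m → E) :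
    taylorForm f a m v = (m ! : ℂ)⁻¹ * ∑ σ : Equiv.Perm (Fin m), p m fun i => v (σ i) := by
  rw [← hf.iteratedFDeriv_eq_sum_of_completeSpace v]
  rfl

theorem taylorForm_apply_const (hf : HasFPowerSeriesOnBall f p a r) (m : ℕ) (z : E) :
    (taylorForm f a m fun _ => z) = p m fun _ => z := by
  rw [taylorForm_apply hf]
  simp only [Finset.sum_const, Finset.card_univ, Fintype.card_perm, Fintype.card_fin, nsmul_eq_mul]
  rw [← mul_assoc, inv_mul_cancel₀ (by exact_mod_cast m.factorial_ne_zero), one_mul]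

theorem taylorForm_eq (hf : HasFPowerSeriesOnBall f p a r) {m : ℕ}
    (hp : IsSymmForm (p m).toMultilinearMap) : taylorForm f a m = (p m).toMultilinearMap := by
  ext v
  rw [taylorForm_apply hf]
  have : ∀ σ : Equiv.Perm (Fin m), (p m fun i => v (σ i)) = p m v := fun σ => hp σ v
  simp only [this, Finset.sum_const, Finset.card_univ, Fintype.card_perm, Fintype.card_fin,
    nsmul_eq_mul]
  rw [← mul_assoc, inv_mul_cancel₀ (by exact_mod_cast m.factorial_ne_zero), one_mul]
  rfl

theorem isSymmForm_taylorForm (hf : HasFPowerSeriesOnBall f p a r) (m : ℕ) :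
    IsSymmForm (taylorForm f a m) := by
  intro σ v
  rw [taylorForm_apply hf, taylorForm_apply hf]
  congr 1
  exact Fintype.sum_equiv (Equiv.mulLeft σ) _ _ fun τ => rfl

end TaylorForm

/-! ### Regularly holomorphic power series -/

namespace ComplexBanachLattice

variable {X E : Type*}
  [NormedAddCommGroup X] [Lattice X] [IsOrderedAddMonoid X] [HasSolidNorm X]
  [NormedSpace ℝ X] [IsOrderedModule ℝ X] [CompleteSpace X]
  [NormedAddCommGroup E] [NormedSpace ℂ E]
  {L : ComplexBanachLattice X E}

/-- Moving the origin of a power series preserves domination by the absolute values. -/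
theorem norm_changeOrigin_le {p q : FormalMultilinearSeries ℂ E ℂ}
    (hpq : ∀ m, L.IsAbsForm (p m).toMultilinearMap (q m).toMultilinearMap) {b : E}
    (hp : (‖b‖₊ : ℝ≥0∞) < p.radius) (hq : (‖b‖₊ : ℝ≥0∞) < q.radius) (k : ℕ) {v : Fin k → X}
    (hv : ∀ i, 0 ≤ v i) :
    ‖p.changeOrigin b k fun i => L.ofReal (v i)‖ ≤
      (q.changeOrigin (L.ofReal (L.abs b)) k fun i => L.ofReal (v i)).re := by
  have hs : ∀ (p : FormalMultilinearSeries ℂ E ℂ) (b : E), (‖b‖₊ : ℝ≥0∞) < p.radius →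
      HasSum (fun l => p.changeOriginSeries k l (fun _ => b) fun i => L.ofReal (v i))
        (p.changeOrigin b k fun i => L.ofReal (v i)) := by
    intro p b hb
    have := (p.hasFPowerSeriesOnBall_changeOrigin k (pos_of_gt hb)).hasSum
      (y := b) (by rwa [mem_eball_zero_iff])
    rw [zero_add] at this
    exact ContinuousMultilinearMap.hasSum_eval this _
  have hb' : (‖L.ofReal (L.abs b)‖₊ : ℝ≥0∞) < q.radius := by
    have : ‖L.ofReal (L.abs b)‖₊ = ‖b‖₊ := by
      ext
      rw [coe_nnnorm, coe_nnnorm, L.norm_ofReal, ← L.norm_eq]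
    rwa [this]
  refine HasSum.norm_le_of_bounded (hs p b hp) (Complex.reCLM.hasSum (hs q _ hb')) fun l => ?_
  -- Each term evaluates `p (k + l)` at `l` copies of `b` and the vectors `v i`; domination replaces
  -- `b` by its modulus and leaves the positive `v i` alone.
  simp only [FormalMultilinearSeries.changeOriginSeries, sum_apply, map_sum]
  refine (norm_sum_le _ _).trans (Finset.sum_le_sum fun s _ => ?_)
  simp only [FormalMultilinearSeries.changeOriginSeriesTerm,
    ContinuousMultilinearMap.curryFinFinset_apply]
  refine ((hpq (k + l)).norm_apply_le _).trans (le_of_eq ?_)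
  rw [reForm_apply]
  refine congrArg (fun t => (q (k + l) t).re) (funext fun i => ?_)
  generalize (finSumEquivOfFinset _ _).symm i = j
  rcases j with j | j
  · rfl
  · simp [L.abs_ofReal_of_nonneg (hv j)]

theorem norm_taylorForm_le {p q : FormalMultilinearSeries ℂ E ℂ} {f g : E → ℂ} {a : E} {r : ℝ≥0∞}
    (hpq : ∀ m, L.IsAbsForm (p m).toMultilinearMap (q m).toMultilinearMap)
    (hf : HasFPowerSeriesOnBall f p a r) (hg : HasFPowerSeriesOnBall g q 0 r) {b : E}
    (hb : (‖b‖₊ : ℝ≥0∞) < r) (k : ℕ) {v : Fin k → X} (hv : ∀ i, 0 ≤ v i) :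
    ‖taylorForm f (a + b) k fun i => L.ofReal (v i)‖ ≤
      L.reForm (taylorForm g (L.ofReal (L.abs b)) k) v := by
  have hb' : (‖L.ofReal (L.abs b)‖₊ : ℝ≥0∞) < r := by
    have : ‖L.ofReal (L.abs b)‖₊ = ‖b‖₊ := by
      ext
      rw [coe_nnnorm, coe_nnnorm, L.norm_ofReal, ← L.norm_eq]
    rwa [this]
  have hg' := hg.changeOrigin hb'
  rw [zero_add] at hg'
  have e : (k ! : ℂ)⁻¹ = (((k ! : ℝ)⁻¹ : ℝ) : ℂ) := by push_cast; rfl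
  rw [reForm_apply, taylorForm_apply (hf.changeOrigin hb), taylorForm_apply hg', norm_mul, e,
    Complex.norm_real, Real.norm_of_nonneg (by positivity), Complex.re_ofReal_mul, Complex.re_sum]
  gcongr
  refine (norm_sum_le _ _).trans (Finset.sum_le_sum fun σ _ => ?_)
  exact norm_changeOrigin_le hpq (hb.trans_le hf.r_le) (hb.trans_le hg.r_le) k fun i => hv (σ i)

/-- A power series is regularly holomorphic on a ball where both it and the series of the absolute
values of its terms converge. -/
theorem regularlyHolomorphicOn_of_hasFPowerSeriesOnBall {p q : FormalMultilinearSeries ℂ E ℂ}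
    {f g : E → ℂ} {a : E} {r : ℝ≥0∞}
    (hpq : ∀ m, L.IsAbsForm (p m).toMultilinearMap (q m).toMultilinearMap)
    (hf : HasFPowerSeriesOnBall f p a r) (hg : HasFPowerSeriesOnBall g q 0 r) {V : Set E}
    (hV : V ⊆ Metric.eball a r) : L.RegularlyHolomorphicOn f V := by
  have shift : ∀ z ∈ V, ∃ b : E, a + b = z ∧ (‖b‖₊ : ℝ≥0∞) < r := fun z hz =>
    ⟨z - a, by abel, by simpa [edist_eq_enorm_sub] using! hV hz⟩
  have habs : ∀ b : E, ‖L.ofReal (L.abs b)‖₊ = ‖b‖₊ := by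
    intro b
    ext
    rw [coe_nnnorm, coe_nnnorm, L.norm_ofReal, ← L.norm_eq]
  have hg' : ∀ b : E, (‖b‖₊ : ℝ≥0∞) < r → HasFPowerSeriesOnBall g
      (q.changeOrigin (L.ofReal (L.abs b))) (L.ofReal (L.abs b)) (r - ‖b‖₊) := by
    intro b hb
    have := hg.changeOrigin (y := L.ofReal (L.abs b)) (by rwa [habs])
    rwa [zero_add, habs] at this
  have hsymm : ∀ b : E, (‖b‖₊ : ℝ≥0∞) < r → ∀ m,
      IsSymmForm (L.reForm (taylorForm g (L.ofReal (L.abs b)) m)) := by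
    intro b hb m σ x
    rw [reForm_apply, reForm_apply,
      isSymmForm_taylorForm (hg' b hb) m σ fun i => L.ofReal (x i)]
  refine ⟨hf.analyticOnNhd.mono hV, fun z hz m => ?_, fun z hz => ?_⟩
  · obtain ⟨b, rfl, hb⟩ := shift z hz
    exact L.isRegular_of_norm_le (isSymmForm_taylorForm (hf.changeOrigin hb) m) (hsymm b hb m)
      fun x hx => norm_taylorForm_le hpq hf hg hb m hx
  · obtain ⟨b, rfl, hb⟩ := shift z hz
    obtain ⟨δ, hδ0, hδ⟩ := ENNReal.lt_iff_exists_nnreal_btwn.1 (tsub_pos_of_lt hb)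
    refine ⟨δ, by exact_mod_cast hδ0, fun w hw => ?_⟩
    have hle : ∀ m (x : Fin m → X), (∀ i, 0 ≤ x i) →
        ‖taylorForm f (a + b) m fun i => L.ofReal (x i)‖ ≤
          L.reForm (taylorForm g (L.ofReal (L.abs b)) m) x :=
      fun m x hx => norm_taylorForm_le hpq hf hg hb m hx
    choose N hN using fun m =>
      L.exists_isAbsForm (isSymmForm_taylorForm (hf.changeOrigin hb) m) (hle m)
    refine ⟨N, hN, ?_⟩
    have hmem : L.ofReal (L.abs w) ∈ Metric.eball (0 : E) (r - ‖b‖₊) := by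
      rw [mem_eball_zero_iff]
      refine lt_trans ?_ hδ
      have : ‖L.ofReal (L.abs w)‖₊ < δ := by rw [habs]; exact_mod_cast hw
      exact_mod_cast this
    have hsum := ((hg' b hb).hasSum hmem).summable
    have hsum' := Complex.reCLM.summable hsum
    -- By leastness the absolute values lie below the Taylor forms of `g` at the modulus of `b`,
    -- whose series converges.
    refine Summable.of_norm_bounded hsum' fun m => ?_
    rw [(hN m).apply_ofReal fun _ => L.abs w, Complex.norm_real,
      Real.norm_of_nonneg ((hN m).reForm_nonneg _ fun _ => L.abs_nonneg w)]
    refine ((hN m).2.2.2 _ (hsymm b hb m) (L.forall_formLE_iff.2 (hle m)) _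
      fun _ => L.abs_nonneg w).trans (le_of_eq ?_)
    rw [reForm_apply, taylorForm_apply_const (hg' b hb)]
    rfl

/-- Regular polynomials of regular norm at most one are, up to the scaling of the variable, the
Taylor polynomials of a regularly holomorphic function on a given bounded set. -/
theorem exists_regularlyHolomorphicOn {A M : ∀ m : ℕ, MultilinearMap ℂ (fun _ : Fin m => E) ℂ}
    (hA : ∀ m, IsSymmForm (A m)) (hM : ∀ m, L.IsAbsForm (A m) (M m))
    (h1 : ∀ m, supNorm (M m) ≤ 1) {V : Set E} (hV : Bornology.IsBounded V) (a : E) :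
    ∃ (R : ℝ) (f : E → ℂ), 0 < R ∧ L.RegularlyHolomorphicOn f V ∧
      ∀ m, taylorForm f a m = (((R⁻¹ ^ m : ℝ)) : ℂ) • A m := by
  obtain ⟨D, hD, hVD⟩ := hV.subset_ball_lt 0 a
  -- The factor `e` absorbs the polarization constant, so the `m`-th coefficient is bounded by
  -- `D^{-m}` and the series converges on the ball of radius `D` containing `V`.
  set R : ℝ := Real.exp 1 * D with hR
  have hR0 : 0 < R := by positivity
  have hc : ∀ m : ℕ, 0 < R⁻¹ ^ m := fun m => by positivity
  have hAM := fun m => (hM m).smul (hc m)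
  have bound : ∀ (m : ℕ) (B N : MultilinearMap ℂ (fun _ : Fin m => E) ℂ), L.IsAbsForm B N →
      supNorm N ≤ 1 → ∀ z : Fin m → E,
        ‖(((R⁻¹ ^ m : ℝ) : ℂ) • B) z‖ ≤ D⁻¹ ^ m * ∏ i, ‖z i‖ := by
    intro m B N hBN hN z
    rw [smul_apply, norm_smul, Complex.norm_real, Real.norm_of_nonneg (hc m).le]
    refine (mul_le_mul_of_nonneg_left (hBN.norm_apply_le_exp hN z) (hc m).le).trans (le_of_eq ?_)
    rw [← mul_assoc, ← mul_pow]
    congr 2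
    rw [hR, mul_inv]
    field_simp
  set p : FormalMultilinearSeries ℂ E ℂ := fun m =>
    (((R⁻¹ ^ m : ℝ) : ℂ) • A m).mkContinuous (D⁻¹ ^ m) (bound m _ _ (hM m) (h1 m)) with hp
  set q : FormalMultilinearSeries ℂ E ℂ := fun m =>
    (((R⁻¹ ^ m : ℝ) : ℂ) • M m).mkContinuous (D⁻¹ ^ m) (bound m _ _ (hM m).self (h1 m)) with hq
  have hrad : ∀ s : FormalMultilinearSeries ℂ E ℂ, (∀ m, ‖s m‖ ≤ D⁻¹ ^ m) →
      ENNReal.ofReal D ≤ s.radius := by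
    intro s hs
    refine s.le_radius_of_bound 1 fun m => ?_
    rw [Real.coe_toNNReal D hD.le]
    refine (mul_le_mul_of_nonneg_right (hs m) (by positivity)).trans (le_of_eq ?_)
    rw [← mul_pow, inv_mul_cancel₀ hD.ne', one_pow]
  have hD' : 0 < ENNReal.ofReal D := ENNReal.ofReal_pos.2 hD
  have hpr := hrad p fun m => MultilinearMap.mkContinuous_norm_le _ (by positivity) _
  have hqr := hrad q fun m => MultilinearMap.mkContinuous_norm_le _ (by positivity) _
  have hg := (q.hasFPowerSeriesOnBall (hD'.trans_le hqr)).mono hD' hqr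
  have hf := ((p.hasFPowerSeriesOnBall (hD'.trans_le hpr)).mono hD' hpr).comp_sub a
  rw [zero_add] at hf
  have hp' : ∀ m, (p m).toMultilinearMap = ((R⁻¹ ^ m : ℝ) : ℂ) • A m := fun m => rfl
  have hq' : ∀ m, (q m).toMultilinearMap = ((R⁻¹ ^ m : ℝ) : ℂ) • M m := fun m => rfl
  refine ⟨R, _, hR0, regularlyHolomorphicOn_of_hasFPowerSeriesOnBall (p := p) (q := q)
    (fun m => by rw [hp', hq']; exact hAM m) hf hg ?_, fun m => ?_⟩
  · rw [Metric.eball_ofReal]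
    exact hVD
  · rw [taylorForm_eq hf, hp']
    rw [hp']
    intro σ z
    simp only [smul_apply, hA m σ z]

end ComplexBanachLattice

/-! ### Norming positive functionals -/

section PositiveFunctional

variable {X : Type*} [NormedAddCommGroup X] [Lattice X] [IsOrderedAddMonoid X] [HasSolidNorm X]
  [NormedSpace ℝ X] [IsOrderedModule ℝ X]

theorem posPart_smul_of_pos {c : ℝ} (hc : 0 < c) (x : X) : (c • x)⁺ = c • x⁺ := by
  have h : ∀ (c : ℝ), 0 < c → ∀ x : X, (c • x)⁺ ≤ c • x⁺ := fun c hc x =>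
    sup_le (smul_le_smul_of_nonneg_left (le_posPart x) hc.le) (smul_nonneg hc.le (posPart_nonneg x))
  refine le_antisymm (h c hc x) ?_
  have := smul_le_smul_of_nonneg_left (h c⁻¹ (inv_pos.2 hc) (c • x)) hc.le
  rwa [smul_smul, inv_mul_cancel₀ hc.ne', one_smul, smul_smul, mul_inv_cancel₀ hc.ne',
    one_smul] at this

/-- Every positive unit vector is normed by a positive functional of norm one. -/
theorem exists_positive_functional {x₀ : X} (h0 : 0 ≤ x₀) (h1 : ‖x₀‖ = 1) :
    ∃ ξ : X →ₗ[ℝ] ℝ, (∀ x, 0 ≤ x → 0 ≤ ξ x) ∧ (∀ x, 0 ≤ x → ξ x ≤ ‖x‖) ∧ ξ x₀ = 1 := by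
  have hne : x₀ ≠ 0 := by
    rintro rfl
    simp at h1
  -- The sublinear bound `‖x⁺‖` vanishes on the negative cone, which forces the Hahn–Banach
  -- extension to be positive.
  obtain ⟨ξ, hξ, hle⟩ := exists_extension_of_le_sublinear
    (LinearPMap.mkSpanSingleton x₀ (1 : ℝ) hne) (fun x => ‖x⁺‖)
    (fun c hc x => by
      rw [posPart_smul_of_pos hc, norm_smul, Real.norm_of_nonneg hc.le])
    (fun x y => by
      refine le_trans ?_ (norm_add_le _ _)
      refine norm_le_norm_of_abs_le_abs ?_
      rw [abs_of_nonneg (posPart_nonneg _),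
        abs_of_nonneg (add_nonneg (posPart_nonneg x) (posPart_nonneg y))]
      exact sup_le (add_le_add (le_posPart x) (le_posPart y))
        (add_nonneg (posPart_nonneg x) (posPart_nonneg y)))
    (by
      rintro ⟨x, hx⟩
      obtain ⟨c, rfl⟩ := Submodule.mem_span_singleton.1 hx
      rw [LinearPMap.mkSpanSingleton'_apply]
      simp only [smul_eq_mul, mul_one]
      rcases le_or_gt c 0 with hc | hc
      · exact hc.trans (norm_nonneg _)
      · rw [posPart_smul_of_pos hc, posPart_eq_self.2 h0, norm_smul, h1, mul_one]
        exact Real.le_norm_self c)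
  refine ⟨ξ, fun x hx => ?_, fun x hx => ?_, ?_⟩
  · have := hle (-x)
    rw [posPart_eq_zero.2 (neg_nonpos.2 hx), norm_zero, map_neg] at this
    linarith
  · have := hle x
    rwa [posPart_eq_self.2 hx] at this
  · have := hξ ⟨x₀, Submodule.mem_span_singleton_self x₀⟩
    rw [this]
    exact LinearPMap.mkSpanSingleton_apply ℝ ℝ hne (1 : ℝ)

end PositiveFunctional

/-! ### Extremal polynomials and sharpness -/

namespace ComplexBanachLattice

variable {X E : Type*}
  [NormedAddCommGroup X] [Lattice X] [IsOrderedAddMonoid X] [HasSolidNorm X]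
  [NormedSpace ℝ X] [IsOrderedModule ℝ X] [CompleteSpace X]
  [NormedAddCommGroup E] [NormedSpace ℂ E]
  (L : ComplexBanachLattice X E) {m : ℕ}

/-- There are positive polynomials of norm one in every degree. -/
theorem exists_positive_form [Nontrivial E] (m : ℕ) :
    ∃ P : MultilinearMap ℂ (fun _ : Fin m => E) ℂ, L.IsAbsForm P P ∧ supNorm P = 1 := by
  obtain ⟨z, hz⟩ := exists_ne (0 : E)
  have hz' : ‖L.abs z‖ ≠ 0 := by rw [← L.norm_eq]; exact norm_ne_zero_iff.2 hz
  set x₀ : X := ‖L.abs z‖⁻¹ • L.abs z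
  have h0 : 0 ≤ x₀ := smul_nonneg (by positivity) (L.abs_nonneg z)
  have h1 : ‖x₀‖ = 1 := by rw [norm_smul, norm_inv, norm_norm, inv_mul_cancel₀ hz']
  obtain ⟨ξ, hpos, hle, hξ⟩ := exists_positive_functional h0 h1
  obtain ⟨Φ, hΦ⟩ := L.exists_complexification (Complex.ofRealCLM.toLinearMap ∘ₗ ξ)
  replace hΦ : ∀ x, Φ (L.ofReal x) = (ξ x : ℂ) := hΦ
  set P : MultilinearMap ℂ (fun _ : Fin m => E) ℂ :=
    (MultilinearMap.mkPiAlgebra ℂ (Fin m) ℂ).compLinearMap fun _ => Φ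
  have hP : ∀ v, P v = ∏ i, Φ (v i) := fun v => rfl
  have hPr : ∀ x : Fin m → X, (P fun i => L.ofReal (x i)) = ((∏ i, ξ (x i) : ℝ) : ℂ) := by
    intro x
    rw [hP]
    simp only [hΦ, Complex.ofReal_prod]
  have hre : ∀ x, L.reForm P x = ∏ i, ξ (x i) := fun x => by
    rw [reForm_apply, hPr, Complex.ofReal_re]
  have habs : L.IsAbsForm P P := by
    refine isAbsForm_self (fun σ v => ?_) (L.imForm_eq_zero fun x _ => ?_) fun x hx => ?_
    · rw [hP, hP]
      exact Equiv.prod_comp σ fun i => Φ (v i)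
    · rw [hPr, Complex.ofReal_im]
    · rw [hre]
      exact Finset.prod_nonneg fun i _ => hpos _ (hx i)
  refine ⟨P, habs, le_antisymm (iSup₂_le fun w hw => ?_) ?_⟩
  · rw [← enorm_one (G := ℂ), enorm_le_iff_norm_le, norm_one]
    refine (habs.norm_apply_le fun _ => w).trans ?_
    rw [hre]
    refine Finset.prod_le_one (fun _ _ => hpos _ (L.abs_nonneg w)) fun _ _ => ?_
    refine (hle _ (L.abs_nonneg w)).trans ?_
    rwa [← L.norm_eq]
  · have := enorm_apply_le_supNorm P (z := L.ofReal x₀) (by rw [L.norm_ofReal, h1])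
    rw [hPr] at this
    simpa [hξ] using this

/-- A positive polynomial is its own absolute value, so its two norms agree. -/
theorem bohrRadius_le_one [Nontrivial E] (hm : m ≠ 0) : L.bohrRadius m ≤ 1 := by
  obtain ⟨P, hP, h1⟩ := L.exists_positive_form m
  have := bohrRadius_mul_le (hP.isRegular hP.1) hm
  rwa [hP.regNorm_eq, h1, ENNReal.one_rpow, mul_one] at this

theorem liminf_bohrRadius_le_one [Nontrivial E] :
    liminf (fun m => L.bohrRadius m) atTop ≤ 1 :=
  liminf_le_of_frequently_le'
    ((eventually_ne_atTop 0).mono fun _ hm => L.bohrRadius_le_one hm).frequently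

variable {L}

/-- Some polynomial violates the Bohr inequality for `ρ`; its regular norm is finite and nonzero,
and dividing by it normalizes. -/
theorem exists_normalized_form {ρ : ℝ≥0} (h : L.bohrRadius m < ρ) :
    ∃ A M : MultilinearMap ℂ (fun _ : Fin m => E) ℂ, IsSymmForm A ∧ L.IsAbsForm A M ∧
      supNorm M = 1 ∧ supNorm A ≤ (ρ : ℝ≥0∞) ^ m := by
  have hex : ∃ A : MultilinearMap ℂ (fun _ : Fin m => E) ℂ, L.IsRegular A ∧
      supNorm A < (ρ : ℝ≥0∞) ^ m * L.regNorm A := by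
    by_contra! hne
    refine absurd h (not_lt.2 ?_)
    exact le_iSup₂ (f := fun (ρ : ℝ≥0) (_ : ∀ A : MultilinearMap ℂ (fun _ : Fin m => E) ℂ,
      L.IsRegular A → (ρ : ℝ≥0∞) ^ m * L.regNorm A ≤ supNorm A) => (ρ : ℝ≥0∞)) ρ hne
  obtain ⟨A, hA, hlt⟩ := hex
  obtain ⟨M, hM⟩ := hA.exists_isAbsForm
  rw [hM.regNorm_eq] at hlt
  have htop : supNorm M ≠ ⊤ := hM.supNorm_lt_top.ne
  have hne : supNorm M ≠ 0 := by
    intro h0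
    simp [h0] at hlt
  set c : ℝ := (supNorm M).toReal⁻¹ with hc
  have hc0 : 0 < c := inv_pos.2 (ENNReal.toReal_pos hne htop)
  have hce : ‖(c : ℂ)‖ₑ = (supNorm M)⁻¹ := by
    rw [← ofReal_norm, Complex.norm_real, Real.norm_of_nonneg hc0.le, hc, ← ENNReal.toReal_inv,
      ENNReal.ofReal_toReal (ENNReal.inv_ne_top.2 hne)]
  refine ⟨(c : ℂ) • A, (c : ℂ) • M, fun σ x => by simp only [smul_apply, hA.1 σ x], hM.smul hc0,
    ?_, ?_⟩
  · rw [supNorm_smul, hce, ENNReal.inv_mul_cancel hne htop]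
  · rw [supNorm_smul, hce]
    refine (mul_le_mul_right hlt.le _).trans (le_of_eq ?_)
    rw [mul_comm, mul_assoc, ENNReal.mul_inv_cancel hne htop, mul_one]

/-- A sequence of polynomials whose norms and regular norms grow at prescribed rates. -/
theorem exists_extremal_forms [Nontrivial E] {τ : ℝ≥0} (hτ0 : τ ≠ 0) (hτ1 : τ ≤ 1)
    (hκ : liminf (fun m => L.bohrRadius m) atTop ≤ τ) :
    ∃ A M : ∀ m : ℕ, MultilinearMap ℂ (fun _ : Fin m => E) ℂ,
      (∀ m, IsSymmForm (A m)) ∧ (∀ m, L.IsAbsForm (A m) (M m)) ∧ (∀ m, supNorm (M m) ≤ 1) ∧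
      limsup (fun m : ℕ => supNorm (A m) ^ (1 / (m : ℝ))) atTop = τ ∧
      limsup (fun m : ℕ => supNorm (M m) ^ (1 / (m : ℝ))) atTop = 1 := by
  set ρ : ℕ → ℝ≥0 := fun j => τ + 1 / ((j : ℝ≥0) + 1) with hρ
  have hfreq : ∀ j, ∃ᶠ m in atTop, L.bohrRadius m < ρ j := fun j => by
    refine frequently_lt_of_liminf_lt (by isBoundedDefault) (hκ.trans_lt ?_)
    have : τ < ρ j := lt_add_of_pos_right τ (by positivity)
    exact_mod_cast this
  -- Only the degrees `n (2 * j)` carry nearly extremal forms. The degrees `n (2 * j + 1)` are left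
  -- to positive forms, so that the value `τ ^ m` occurs infinitely often and the limsup is not
  -- below `τ`.
  obtain ⟨n, hn, hnK⟩ := extraction_forall_of_frequently hfreq
  have hex : ∀ m : ℕ, ∃ A M : MultilinearMap ℂ (fun _ : Fin m => E) ℂ, IsSymmForm A ∧
      L.IsAbsForm A M ∧ supNorm M ≤ 1 ∧
      (∀ j, n (2 * j) = m → supNorm M = 1 ∧ supNorm A ≤ (ρ (2 * j) : ℝ≥0∞) ^ m) ∧
      ((∀ j, n (2 * j) ≠ m) → supNorm A = (τ : ℝ≥0∞) ^ m) := by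
    intro m
    by_cases h : ∃ j, n (2 * j) = m
    · obtain ⟨j, rfl⟩ := h
      obtain ⟨A, M, hA, hM, h1, h2⟩ := exists_normalized_form (hnK (2 * j))
      refine ⟨A, M, hA, hM, h1.le, fun i hi => ?_, fun h => absurd rfl (h j)⟩
      have : 2 * i = 2 * j := hn.injective hi
      rw [this]
      exact ⟨h1, h2⟩
    · push Not at h
      obtain ⟨P, hP, h1⟩ := L.exists_positive_form m
      have hc : (0 : ℝ) < (τ : ℝ) ^ m := pow_pos (NNReal.coe_pos.2 (pos_iff_ne_zero.2 hτ0)) m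
      have e : supNorm ((((τ : ℝ) ^ m : ℝ) : ℂ) • P) = (τ : ℝ≥0∞) ^ m := by
        rw [supNorm_smul, h1, mul_one, ← ofReal_norm, Complex.norm_real,
          Real.norm_of_nonneg hc.le, ENNReal.ofReal_pow τ.coe_nonneg, ENNReal.ofReal_coe_nnreal]
      refine ⟨_, _, (hP.smul hc).1, hP.smul hc, ?_, fun j hj => absurd hj (h j), fun _ => e⟩
      rw [e]
      exact pow_le_one₀ zero_le (by exact_mod_cast hτ1)
  choose A M hA hM h1 hj hnj using hex
  have hroot : ∀ (m : ℕ) (s : ℝ≥0∞), m ≠ 0 → (s ^ m) ^ (1 / (m : ℝ)) = s := fun m s hm => by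
    rw [one_div, ENNReal.pow_rpow_inv_natCast hm]
  refine ⟨A, M, hA, hM, h1, le_antisymm ?_ ?_, le_antisymm ?_ ?_⟩
  · refine ENNReal.le_of_forall_pos_le_add fun δ hδ _ => ?_
    obtain ⟨J, hJ⟩ := exists_nat_one_div_lt (NNReal.coe_pos.2 hδ)
    refine limsup_le_of_le (by isBoundedDefault) ?_
    filter_upwards [eventually_gt_atTop (n (2 * J))] with m hm
    have hm0 : m ≠ 0 := (zero_le.trans_lt hm).ne'
    by_cases h : ∃ j, n (2 * j) = m
    · obtain ⟨j, hjm⟩ := h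
      have hlt : 2 * J < 2 * j := hn.lt_iff_lt.1 (hjm ▸ hm)
      have := ENNReal.rpow_le_rpow (hj m j hjm).2 (z := 1 / (m : ℝ)) (by positivity)
      rw [hroot m _ hm0] at this
      refine this.trans ?_
      have hle : ρ (2 * j) ≤ τ + δ := by
        refine add_le_add_right ?_ τ
        rw [← NNReal.coe_le_coe]
        refine le_trans ?_ hJ.le
        push_cast
        have : (J : ℝ) ≤ 2 * j := by exact_mod_cast (by omega : J ≤ 2 * j)
        gcongr
      exact_mod_cast hle
    · push Not at h
      rw [hnj m h, hroot m _ hm0]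
      exact le_self_add
  · refine le_limsup_of_frequently_le (frequently_atTop.2 fun N => ⟨n (2 * N + 1), ?_, ?_⟩)
    · have := hn.le_apply (x := 2 * N + 1)
      omega
    · have hm0 : n (2 * N + 1) ≠ 0 := by
        have := hn.le_apply (x := 2 * N + 1)
        omega
      rw [hnj, hroot _ _ hm0]
      intro j hj
      have := hn.injective hj
      omega
  · refine limsup_le_of_le (by isBoundedDefault) (Eventually.of_forall fun m => ?_)
    exact ENNReal.rpow_le_one (h1 m) (by positivity)
  · refine le_limsup_of_frequently_le (frequently_atTop.2 fun N => ⟨n (2 * N), ?_, ?_⟩)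
    · have := hn.le_apply (x := 2 * N)
      omega
    · rw [(hj _ N rfl).1, ENNReal.one_rpow]

theorem limsup_root_smul {b : ℕ → ℝ≥0∞} {c : ℝ≥0∞} (hc : c ≠ ⊤) :
    limsup (fun m : ℕ => (c ^ m * b m) ^ (1 / (m : ℝ))) atTop =
      c * limsup (fun m : ℕ => b m ^ (1 / (m : ℝ))) atTop := by
  rw [← ENNReal.limsup_const_mul_of_ne_top hc]
  refine limsup_congr ((eventually_ne_atTop 0).mono fun m hm => ?_)
  rw [ENNReal.mul_rpow_of_nonneg _ _ (by positivity), one_div, ENNReal.pow_rpow_inv_natCast hm]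

/-- Every ratio between the lower limit of the Bohr radii and one is attained. -/
theorem exists_regConvRadius_eq [Nontrivial E] {V : Set E} (hV : Bornology.IsBounded V) (a : E)
    {τ : ℝ≥0} (hτ0 : τ ≠ 0) (hτ1 : τ ≤ 1)
    (hκ : liminf (fun m => L.bohrRadius m) atTop ≤ τ) :
    ∃ f : E → ℂ, L.RegularlyHolomorphicOn f V ∧ convRadius f a < ⊤ ∧
      L.regConvRadius f a = τ * convRadius f a := by
  obtain ⟨A, M, hA, hM, h1, hlA, hlM⟩ := exists_extremal_forms hτ0 hτ1 hκ
  obtain ⟨R, f, hR, hf, hT⟩ := exists_regularlyHolomorphicOn hA hM h1 hV a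
  have hc : ∀ m : ℕ, 0 < R⁻¹ ^ m := fun m => by positivity
  set c : ℝ≥0∞ := ENNReal.ofReal R⁻¹
  have hc0 : c ≠ 0 := (ENNReal.ofReal_pos.2 (inv_pos.2 hR)).ne'
  have hct : c ≠ ⊤ := ENNReal.ofReal_ne_top
  have hcm : ∀ m : ℕ, ‖((R⁻¹ ^ m : ℝ) : ℂ)‖ₑ = c ^ m := fun m => by
    rw [← ofReal_norm, Complex.norm_real, Real.norm_of_nonneg (hc m).le,
      ENNReal.ofReal_pow (inv_nonneg.2 hR.le)]
  -- The rescaling enters both radii through the same factor and cancels in the ratio.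
  have e1 : convRadius f a = (c * τ)⁻¹ := by
    rw [convRadius]
    simp only [hT, supNorm_smul, hcm]
    rw [limsup_root_smul hct, hlA]
  have e2 : L.regConvRadius f a = c⁻¹ := by
    rw [regConvRadius]
    simp only [hT, ((hM _).smul (hc _)).regNorm_eq, supNorm_smul, hcm]
    rw [limsup_root_smul hct, hlM, mul_one]
  have hτ0' : (τ : ℝ≥0∞) ≠ 0 := by exact_mod_cast hτ0
  refine ⟨f, hf, ?_, ?_⟩
  · rw [e1]
    exact ENNReal.inv_lt_top.2 (pos_iff_ne_zero.2 (mul_ne_zero hc0 hτ0'))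
  · rw [e1, e2, ENNReal.mul_inv (Or.inl hc0) (Or.inl hct), mul_comm, mul_assoc,
      ENNReal.inv_mul_cancel hτ0' ENNReal.coe_ne_top, mul_one]

end ComplexBanachLattice

theorem theorem5p2 {X E : Type*}
    [NormedAddCommGroup X] [Lattice X] [IsOrderedAddMonoid X] [HasSolidNorm X]
    [NormedSpace ℝ X] [IsOrderedModule ℝ X] [CompleteSpace X]
    [NormedAddCommGroup E] [NormedSpace ℂ E]
    (L : ComplexBanachLattice X E) :
    -- the two inequalities
    (∀ (U : Set E), IsOpen U → ∀ f : E → ℂ, L.RegularlyHolomorphicOn f U → ∀ a ∈ U,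
      liminf (fun m => L.bohrRadius m) atTop * convRadius f a ≤ L.regConvRadius f a ∧
      L.regConvRadius f a ≤ convRadius f a) ∧
    -- sharpness, at every point of every bounded open set
    (Nontrivial E → ∀ V : Set E, IsOpen V → Bornology.IsBounded V → ∀ a ∈ V,
      -- the upper bound is attained
      (∃ f : E → ℂ, L.RegularlyHolomorphicOn f V ∧ convRadius f a < ⊤ ∧
        L.regConvRadius f a = convRadius f a) ∧
      -- the lower bound is attained if the lower limit of the Bohr radii is positive
      (0 < liminf (fun m => L.bohrRadius m) atTop →
        ∃ f : E → ℂ, L.RegularlyHolomorphicOn f V ∧ convRadius f a < ⊤ ∧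
          L.regConvRadius f a = liminf (fun m => L.bohrRadius m) atTop * convRadius f a) ∧
      -- the lower bound is approached if this lower limit is zero
      (liminf (fun m => L.bohrRadius m) atTop = 0 →
        ∀ ε : ℝ≥0∞, 0 < ε → ∃ f : E → ℂ, L.RegularlyHolomorphicOn f V ∧ convRadius f a < ⊤ ∧
          L.regConvRadius f a ≤ ε * convRadius f a)) := by
  refine ⟨fun U _ f hf a ha => ⟨ComplexBanachLattice.liminf_bohrRadius_mul_convRadius_le f a
    (hf.2.1 a ha), L.regConvRadius_le_convRadius f a⟩, fun _ V _ hV a _ => ⟨?_, ?_, ?_⟩⟩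
  · simpa using ComplexBanachLattice.exists_regConvRadius_eq (L := L) hV a one_ne_zero le_rfl
      (by simpa using L.liminf_bohrRadius_le_one)
  · intro hpos
    have h1 := L.liminf_bohrRadius_le_one
    lift liminf (fun m => L.bohrRadius m) atTop to ℝ≥0 using (h1.trans_lt ENNReal.one_lt_top).ne
      with κ hκ
    exact ComplexBanachLattice.exists_regConvRadius_eq hV a (by exact_mod_cast hpos.ne')
      (by exact_mod_cast h1) hκ.ge
  · intro h0 ε hε
    -- The ratio `0` cannot be prescribed, so some positive `τ` below both `ε` and `1` is used.
    obtain ⟨τ, hτ0, hτ⟩ := ENNReal.lt_iff_exists_nnreal_btwn.1 (lt_min hε one_pos)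
    obtain ⟨hτε, hτ1⟩ := lt_min_iff.1 hτ
    obtain ⟨f, hf, hr, e⟩ := ComplexBanachLattice.exists_regConvRadius_eq (L := L) hV a
      (τ := τ) (by exact_mod_cast hτ0.ne') (by exact_mod_cast hτ1.le) (by rw [h0]; exact zero_le)
    exact ⟨f, hf, hr, e.le.trans (mul_le_mul_left hτε.le _)⟩
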